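/- Write $\phi(t)=\frac23 t^{3/2}$. Let $5<p<9$ and $q=p+1$. Then there exist real constants $\alpha,\beta$ with $$\alpha+\frac16+\beta=\frac{5}{3q},\qquad \beta<\frac1q,$$ and a constant $C>0$, depending only on $q,\alpha,\beta$, such that the following holds for all $M>1$ and $0<T_0<1$. Let $F$ be a locally integrable real function on $[0,\infty)\times\mathbb R$ with $F(t,x)=0$ whenever $|x|>\phi(t)+M-1$ and with $F(t,x)=0$ whenever $0\le t<T_0/2$, and let $w$ be a locally integrable solution of $$\partial_t^2w-t\,\partial_x^2w=F\ \text{ in }(0,\infty)\times\mathbb R,\qquad w(0,x)=0,\quad \partial_tw(0,x)=0,$$ in the sense of distributions, i.e. $\int_0^\infty\!\int_{\mathbb R} w\,(\partial_t^2\psi-t\,\partial_x^2\psi)\,dx\,dt=\int_0^\infty\!\int_{\mathbb R}F\psi\,dx\,dt$ for all $\psi\in C_c^\infty(\mathbb R^2)$. Then $$\Big\|\big((\phi(t)+M)^2-x^2\big)^{-\alpha}w\Big\|_{L^q([T_0/2,\infty)\times\mathbb R)}\le C\,\Big\|\big((\phi(t)+M)^2-x^2\big)^{\beta}F\Big\|_{L^{q/(q-1)}([T_0/2,\infty)\times\mathbb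 R)},$$ where the right-hand side may be $+\infty$. (No smoothness of $F$ is required; in particular this covers $F\in C^\infty([0,T_0]\times\mathbb R)$.) -/

import Mathlib

open MeasureTheory Set
open scoped ContDiff

/-- The function `φ(t) = (2/3) t^(3/2)`; the curves `x ± φ(t) = const` are the characteristics of
the Tricomi operator `∂ₜ² - t ∂ₓ²`. -/
noncomputable def tricomiPhi (t : ℝ) : ℝ := 2 / 3 * t ^ (3 / 2 : ℝ)

/-- The Tricomi operator `∂ₜ² ψ - t ∂ₓ² ψ`, for functions of `z = (t, x)`. -/
noncomputable def tricomiOp (ψ : ℝ × ℝ → ℝ) (z : ℝ × ℝ) : ℝ :=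
  iteratedDeriv 2 (fun s : ℝ => ψ (s, z.2)) z.1 - z.1 * iteratedDeriv 2 (fun y : ℝ => ψ (z.1, y)) z.2

/-- `w` is a distributional solution of the Cauchy problem
`∂ₜ² w - t ∂ₓ² w = F` in `(0,∞) × ℝ`, `w(0,x) = 0`, `∂ₜ w(0,x) = 0`.
Only the values of `w` and `F` at times `t ≥ 0` matter. The test functions are smooth and compactly
supported in the whole plane, so they need not vanish near `t = 0`; since no boundary terms appear,
the identity carries both the equation and the zero initial data. (The Tricomi operator is formally
self-adjoint, as its coefficient `t` does not depend on `x`.) -/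
structure IsTricomiSolution (F w : ℝ × ℝ → ℝ) : Prop where
  locallyIntegrable_source : LocallyIntegrableOn F (Ici 0 ×ˢ univ) volume
  locallyIntegrable_sol : LocallyIntegrableOn w (Ici 0 ×ˢ univ) volume
  weak_eq : ∀ ψ : ℝ × ℝ → ℝ, ContDiff ℝ ∞ ψ → HasCompactSupport ψ →
    ∫ z in Ioi (0 : ℝ) ×ˢ univ, w z * tricomiOp ψ z = ∫ z in Ioi (0 : ℝ) ×ˢ univ, F z * ψ z

/-- The norm `‖((φ(t) + M)² - x²)^μ f‖` in `L^r([a,∞) × ℝ)`, with values in `[0,∞]`. -/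
noncomputable def weightedNorm (M a μ r : ℝ) (f : ℝ × ℝ → ℝ) : ENNReal :=
  eLpNorm (fun z : ℝ × ℝ => ((tricomiPhi z.1 + M) ^ 2 - z.2 ^ 2) ^ μ * f z) (ENNReal.ofReal r)
    (volume.restrict (Ici a ×ˢ univ))

/-! ### The hypergeometric function `₂F₁(1/6, 1/6; 1; z)` -/

/-! The choice is `β = 0`, `α = 5/(3q) - 1/6`, which is positive because `q < 10`. The estimate then
follows from a pointwise bound for the Riemann function and a Schur-type test.

Kernel bound. In the coordinates `u = φ(t) + x`, `v = φ(t) - x`, multiplying a solution by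
`((u+v)/2)^(1/6)` removes the first-order terms and leaves the operator `g_uv + (5/36)(u+v)⁻² g`.
Its Riemann function is `(1-z)^(1/6) ₂F₁(1/6,1/6;1;z)` with `z` the rational function `riemannArg`.
The hypergeometric factor is bounded on `[0,1)`, since its Taylor coefficients are summable. Undoing
the change of variables, all powers of the source time cancel, and a function vanishing for small
times satisfies `|W(z)| ≤ A ∫ D(z,ζ)^(-1/6) |(∂ₜ² - t∂ₓ²)W(ζ)| dζ` over the backward cone, where `D
= coneDist` (`exists_enorm_le_lintegral_cone`).

Weighted bound. If the source lives in `|y| ≤ φ(s) + M`, then `D` is at most `(φ(t)+M)² - x²`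
(`coneDist_le`), so the weight to the power `-α` is at most `D^(-α)` and the weighted kernel is at
most `D^(-5/(3q)) = (D^(-5/6))^(2/q)`. One space integral of `D^(-5/6)` costs a multiple of `1/t`,
the scale-invariant rate, so the factors `(s/t)^(∓1/2)` make the two integrals required by
`lintegral_kernel_rpow_le` finite uniformly in `M` (`lintegral_weight_mul_cone_rpow_le`).

Weak solutions. The zero extension of `w` to negative times is convolved with a tensor mollifier
supported at strictly positive times: the result is smooth, vanishes for small times, and solves the
equation with the mollified source plus a commutator coming from the variable coefficient `t`. The
time scale is chosen after the space scale, which makes the commutator small in `L¹`. Along a fast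
sequence of scales the errors tend to zero almost everywhere (`exists_mollifier_seq`). Mollifying
does not increase the `L^{q'}` norm of the source and moves its support by less than the margin `1`
in the hypothesis, so Fatou's lemma gives the estimate (`exists_lintegral_weight_rpow_le`). -/

theorem summable_mul_pow_of_le_pow {a : ℕ → ℝ} {C : ℝ} {k : ℕ}
    (ha : ∀ n, |a n| ≤ C * ((n : ℝ) + 1) ^ k) {z : ℝ} (hz : |z| < 1) :
    Summable fun n => a n * z ^ n := by
  have h1 : Summable fun n : ℕ => (((n + 1 : ℕ) : ℝ)) ^ k * |z| ^ (n + 1) :=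
    (summable_nat_add_iff (f := fun n : ℕ => (n : ℝ) ^ k * |z| ^ n) 1).2
      (summable_pow_mul_geometric_of_norm_lt_one k (by simpa using hz))
  rcases eq_or_ne z 0 with rfl | hz0
  · refine summable_of_ne_finset_zero (s := {0}) fun n hn => ?_
    have : n ≠ 0 := by simpa using hn
    simp [this]
  · refine Summable.of_norm_bounded (h1.mul_left (C * |z|⁻¹)) fun n => ?_
    have hz1 : |z| ≠ 0 := by simpa using hz0
    rw [Real.norm_eq_abs, abs_mul, abs_pow]
    calc |a n| * |z| ^ n ≤ (C * ((n : ℝ) + 1) ^ k) * |z| ^ n := by gcongr; exact ha n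
      _ = _ := by push_cast; rw [pow_succ]; field_simp

/-- Polynomial growth passes to the coefficients of the derived series at the cost of one degree;
this lets `hasDerivAt_tsum_mul_pow` be iterated. -/
theorem abs_succ_mul_le {a : ℕ → ℝ} {C : ℝ} {k : ℕ}
    (ha : ∀ n, |a n| ≤ C * ((n : ℝ) + 1) ^ k) (n : ℕ) :
    |((n : ℝ) + 1) * a (n + 1)| ≤ (C * 2 ^ k) * ((n : ℝ) + 1) ^ (k + 1) := by
  have hC : 0 ≤ C := by simpa using (abs_nonneg _).trans (ha 0)
  have h2 : |a (n + 1)| ≤ C * (2 * ((n : ℝ) + 1)) ^ k := by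
    refine (ha (n + 1)).trans ?_
    push_cast
    gcongr
    have : (0 : ℝ) ≤ n := n.cast_nonneg
    linarith
  rw [abs_mul, abs_of_pos (by positivity : (0 : ℝ) < (n : ℝ) + 1)]
  calc ((n : ℝ) + 1) * |a (n + 1)| ≤ ((n : ℝ) + 1) * (C * (2 * ((n : ℝ) + 1)) ^ k) := by gcongr
    _ = _ := by rw [mul_pow]; ring

theorem hasDerivAt_tsum_mul_pow {a : ℕ → ℝ} {C : ℝ} {k : ℕ}
    (ha : ∀ n, |a n| ≤ C * ((n : ℝ) + 1) ^ k) {z : ℝ} (hz : |z| < 1) :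
    HasDerivAt (fun z => ∑' n, a n * z ^ n) (∑' n : ℕ, (((n : ℝ) + 1) * a (n + 1)) * z ^ n) z := by
  obtain ⟨r, hzr, hr⟩ := exists_between hz
  have hr0 : 0 < r := (abs_nonneg z).trans_lt hzr
  have hr' : |r| < 1 := by rwa [abs_of_pos hr0]
  have hC : 0 ≤ C := by simpa using (abs_nonneg _).trans (ha 0)
  have hb := abs_succ_mul_le ha
  have hsum : Summable fun n : ℕ => |((n : ℝ) + 1) * a (n + 1)| * r ^ n :=
    summable_mul_pow_of_le_pow (fun n => by simpa using hb n) hr'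
  have hu : Summable fun n : ℕ => |(n : ℝ) * a n| * r ^ (n - 1) := by
    rw [← summable_nat_add_iff 1]
    simpa using hsum
  have key := hasDerivAt_tsum_of_isPreconnected (g := fun n z => a n * z ^ n)
    (g' := fun n z => a n * (n * z ^ (n - 1))) (t := Metric.ball (0 : ℝ) r) (y₀ := z) (y := z) hu
    Metric.isOpen_ball (convex_ball _ _).isPreconnected
    (fun n y _ => (hasDerivAt_pow n y).const_mul _)
    (fun n y hy => by
      have hy : |y| < r := by simpa using hy
      rw [Real.norm_eq_abs, abs_mul, abs_mul, abs_mul, abs_pow]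
      calc |a n| * (|(n : ℝ)| * |y| ^ (n - 1)) ≤ |a n| * (|(n : ℝ)| * r ^ (n - 1)) := by gcongr
        _ = _ := by ring)
    (by simpa using hzr) (summable_mul_pow_of_le_pow ha hz) (by simpa using hzr)
  refine key.congr_deriv ?_
  have hs : Summable fun n : ℕ => a n * (n * z ^ (n - 1)) := by
    rw [← summable_nat_add_iff 1]
    refine (summable_mul_pow_of_le_pow hb hz).congr fun n => ?_
    push_cast
    ring
  rw [hs.tsum_eq_zero_add]
  simp only [Nat.cast_zero, zero_mul, mul_zero, zero_add]
  refine tsum_congr fun n => ?_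
  push_cast
  ring

/-- The coefficients `((1/6)ₙ / n!)²` of `₂F₁(1/6, 1/6; 1; z)`. -/
noncomputable def hypCoeff : ℕ → ℝ
  | 0 => 1
  | n + 1 => hypCoeff n * (((n : ℝ) + 1 / 6) / ((n : ℝ) + 1)) ^ 2

theorem hypCoeff_pos (n : ℕ) : 0 < hypCoeff n := by
  induction n with
  | zero => simp [hypCoeff]
  | succ n ih => rw [hypCoeff]; positivity

theorem hypCoeff_succ (n : ℕ) :
    ((n : ℝ) + 1) ^ 2 * hypCoeff (n + 1) = ((n : ℝ) + 1 / 6) ^ 2 * hypCoeff n := by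
  rw [hypCoeff]
  have : (n : ℝ) + 1 ≠ 0 := by positivity
  field_simp

/-- The true decay is `n^(-5/3)`; the weaker rate `n^(-3/2)` suffices for summability, and squaring
it leaves a polynomial inequality for the induction. -/
theorem hypCoeff_succ_sq_le (n : ℕ) : hypCoeff (n + 1) ^ 2 ≤ 1 / ((n : ℝ) + 1) ^ 3 := by
  induction n with
  | zero => norm_num [hypCoeff]
  | succ n ih =>
    rw [hypCoeff, mul_pow]
    push_cast
    have hn : (0 : ℝ) ≤ n := n.cast_nonneg
    calc hypCoeff (n + 1) ^ 2 * ((((n : ℝ) + 1 + 1 / 6) / ((n : ℝ) + 1 + 1)) ^ 2) ^ 2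
        ≤ 1 / ((n : ℝ) + 1) ^ 3 * ((((n : ℝ) + 1 + 1 / 6) / ((n : ℝ) + 1 + 1)) ^ 2) ^ 2 := by
          gcongr
      _ ≤ 1 / ((n : ℝ) + 1 + 1) ^ 3 := by
          rw [div_pow, div_pow, div_mul_div_comm, one_mul, div_le_div_iff₀ (by positivity)
            (by positivity), ← sub_nonneg]
          ring_nf
          positivity

theorem summable_hypCoeff : Summable hypCoeff := by
  rw [← summable_nat_add_iff 1]
  have h : Summable fun n : ℕ => 1 / (((n + 1 : ℕ) : ℝ)) ^ (3 / 2 : ℝ) :=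
    (summable_nat_add_iff (f := fun n : ℕ => 1 / (n : ℝ) ^ (3 / 2 : ℝ)) 1).2
      (Real.summable_one_div_nat_rpow.2 (by norm_num))
  refine Summable.of_nonneg_of_le (fun n => (hypCoeff_pos _).le) (fun n => ?_) h
  refine le_of_sq_le_sq ?_ (by positivity)
  refine (hypCoeff_succ_sq_le n).trans (le_of_eq ?_)
  push_cast
  rw [div_pow, ← Real.rpow_natCast (((n : ℝ) + 1) ^ (3 / 2 : ℝ)) 2,
    ← Real.rpow_mul (by positivity), one_pow, ← Real.rpow_natCast]
  norm_num

theorem hypCoeff_le_one (n : ℕ) : |hypCoeff n| ≤ 1 * ((n : ℝ) + 1) ^ 0 := by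
  rw [abs_of_pos (hypCoeff_pos n)]
  induction n with
  | zero => simp [hypCoeff]
  | succ n ih =>
    rw [hypCoeff]
    have hn : (0 : ℝ) ≤ n := n.cast_nonneg
    have h1 : ((n : ℝ) + 1 / 6) / ((n : ℝ) + 1) ≤ 1 := by
      rw [div_le_one (by positivity)]; linarith
    have h2 : (((n : ℝ) + 1 / 6) / ((n : ℝ) + 1)) ^ 2 ≤ 1 := pow_le_one₀ (by positivity) h1
    have := hypCoeff_pos n
    simp only [pow_zero, mul_one] at ih ⊢
    calc _ ≤ 1 * (1 : ℝ) := by gcongr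
      _ = 1 := one_mul 1

/-- `₂F₁(1/6, 1/6; 1; z)` for `|z| < 1`. -/
noncomputable def hyp (z : ℝ) : ℝ := ∑' n, hypCoeff n * z ^ n

/-- The derivative of `hyp`. -/
noncomputable def hyp' (z : ℝ) : ℝ := ∑' n : ℕ, (((n : ℝ) + 1) * hypCoeff (n + 1)) * z ^ n

/-- The second derivative of `hyp`. -/
noncomputable def hyp'' (z : ℝ) : ℝ :=
  ∑' n : ℕ, (((n : ℝ) + 1) * (((n + 1 : ℕ) + 1 : ℝ) * hypCoeff (n + 1 + 1))) * z ^ n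

theorem hasDerivAt_hyp {z : ℝ} (hz : |z| < 1) : HasDerivAt hyp (hyp' z) z :=
  hasDerivAt_tsum_mul_pow hypCoeff_le_one hz

theorem hasDerivAt_hyp' {z : ℝ} (hz : |z| < 1) : HasDerivAt hyp' (hyp'' z) z :=
  hasDerivAt_tsum_mul_pow (abs_succ_mul_le hypCoeff_le_one) hz

theorem hyp_zero : hyp 0 = 1 := by
  rw [hyp, tsum_eq_single 0 (fun n hn => by simp [hn])]
  simp [hypCoeff]

/-- Comparing coefficients of `z ^ n`, the equation is exactly the recurrence `hypCoeff_succ`;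
multiplication by `z` shifts the series by one index. -/
theorem hyp_ode {z : ℝ} (hz : |z| < 1) :
    z * (1 - z) * hyp'' z + (1 - 4 / 3 * z) * hyp' z - hyp z / 36 = 0 := by
  have b0 := hypCoeff_le_one
  have b1 := abs_succ_mul_le b0
  have b2 := abs_succ_mul_le b1
  have s0 : HasSum (fun n => hypCoeff n * z ^ n) (hyp z) :=
    (summable_mul_pow_of_le_pow b0 hz).hasSum
  have s1 : HasSum (fun n : ℕ => (((n : ℝ) + 1) * hypCoeff (n + 1)) * z ^ n) (hyp' z) :=
    (summable_mul_pow_of_le_pow b1 hz).hasSum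
  have s2 : HasSum (fun n : ℕ =>
      (((n : ℝ) + 1) * (((n + 1 : ℕ) + 1 : ℝ) * hypCoeff (n + 1 + 1))) * z ^ n) (hyp'' z) :=
    (summable_mul_pow_of_le_pow b2 hz).hasSum
  have shift : ∀ {c : ℕ → ℝ} {S : ℝ}, c 0 = 0 → HasSum (fun n => c (n + 1) * z ^ n) S →
      HasSum (fun n => c n * z ^ n) (z * S) := by
    intro c S hc hS
    rw [← hasSum_nat_add_iff' 1]
    simp only [Finset.range_one, Finset.sum_singleton, hc, zero_mul, sub_zero]
    refine (hS.mul_left z).congr_fun fun n => ?_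
    ring
  have s11 : HasSum (fun n : ℕ => ((n : ℝ) * hypCoeff n) * z ^ n) (z * hyp' z) :=
    shift (c := fun n : ℕ => (n : ℝ) * hypCoeff n) (by simp) (by simpa using s1)
  have s21 : HasSum (fun n : ℕ => ((n : ℝ) * (((n : ℝ) + 1) * hypCoeff (n + 1))) * z ^ n)
      (z * hyp'' z) :=
    shift (c := fun n : ℕ => (n : ℝ) * (((n : ℝ) + 1) * hypCoeff (n + 1))) (by simp)
      (by simpa using s2)
  have s22 : HasSum (fun n : ℕ => (((n : ℝ) - 1) * ((n : ℝ) * hypCoeff n)) * z ^ n)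
      (z * (z * hyp'' z)) :=
    shift (c := fun n : ℕ => ((n : ℝ) - 1) * ((n : ℝ) * hypCoeff n)) (by simp)
      (by simpa using s21)
  have tot := ((((s21.sub s22).add s1).sub (s11.mul_left (4 / 3))).sub (s0.mul_left (1 / 36)))
  have hzero : ∀ n : ℕ, (n : ℝ) * (((n : ℝ) + 1) * hypCoeff (n + 1)) * z ^ n
      - ((n : ℝ) - 1) * ((n : ℝ) * hypCoeff n) * z ^ n + ((n : ℝ) + 1) * hypCoeff (n + 1) * z ^ n
      - 4 / 3 * ((n : ℝ) * hypCoeff n * z ^ n) - 1 / 36 * (hypCoeff n * z ^ n) = 0 := by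
    intro n
    linear_combination z ^ n * hypCoeff_succ n
  have h0 := tot.unique (by simpa only [hzero] using hasSum_zero)
  linear_combination h0

/-- The coefficients are positive and summable, so their sum is a bound up to the singular point `z
= 1`. -/
theorem exists_abs_hyp_le : ∃ A : ℝ, 0 < A ∧ ∀ z : ℝ, 0 ≤ z → z < 1 → |hyp z| ≤ A := by
  refine ⟨∑' n, hypCoeff n, summable_hypCoeff.tsum_pos (fun n => (hypCoeff_pos n).le) 0
    (hypCoeff_pos 0), fun z hz0 hz1 => ?_⟩
  have hle : ∀ n, hypCoeff n * z ^ n ≤ hypCoeff n := fun n =>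
    mul_le_of_le_one_right (hypCoeff_pos n).le (pow_le_one₀ hz0 hz1.le)
  have hs : Summable fun n => hypCoeff n * z ^ n :=
    summable_hypCoeff.of_nonneg_of_le (fun n => by have := hypCoeff_pos n; positivity) hle
  rw [hyp, abs_of_nonneg (tsum_nonneg fun n => by have := hypCoeff_pos n; positivity)]
  exact hs.tsum_le_tsum hle summable_hypCoeff

/-- `(1 - z)^(1/6) ₂F₁(1/6, 1/6; 1; z)`, the profile of the Riemann function. -/
noncomputable def riemannProfile (z : ℝ) : ℝ := (1 - z) ^ (1 / 6 : ℝ) * hyp z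

/-- The derivative of `riemannProfile`. -/
noncomputable def riemannProfile' (z : ℝ) : ℝ :=
  (1 - z) ^ (1 / 6 : ℝ) * (hyp' z - hyp z / (6 * (1 - z)))

/-- The second derivative of `riemannProfile`. -/
noncomputable def riemannProfile'' (z : ℝ) : ℝ :=
  (1 - z) ^ (1 / 6 : ℝ) * (hyp'' z - hyp' z / (3 * (1 - z)) - 5 / 36 * hyp z / (1 - z) ^ 2)

theorem hasDerivAt_one_sub_rpow {z : ℝ} (hz : z < 1) :
    HasDerivAt (fun z : ℝ => (1 - z) ^ (1 / 6 : ℝ))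
      (-(1 - z) ^ (1 / 6 : ℝ) / (6 * (1 - z))) z := by
  have h1 : 0 < 1 - z := by linarith
  refine (((hasDerivAt_id z).const_sub 1).rpow_const (p := 1 / 6)
    (Or.inl h1.ne')).congr_deriv ?_
  rw [id, Real.rpow_sub h1, Real.rpow_one]
  field_simp

theorem hasDerivAt_riemannProfile {z : ℝ} (hz : |z| < 1) :
    HasDerivAt riemannProfile (riemannProfile' z) z := by
  have hz1 := (abs_lt.1 hz).2
  have h1 : 1 - z ≠ 0 := by linarith
  refine ((hasDerivAt_one_sub_rpow hz1).mul (hasDerivAt_hyp hz)).congr_deriv ?_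
  rw [riemannProfile']
  field_simp
  ring

theorem hasDerivAt_riemannProfile' {z : ℝ} (hz : |z| < 1) :
    HasDerivAt riemannProfile' (riemannProfile'' z) z := by
  have hz1 := (abs_lt.1 hz).2
  have h1 : 1 - z ≠ 0 := by linarith
  have h2 : HasDerivAt (fun z : ℝ => 6 * (1 - z)) (-6) z := by
    simpa using ((hasDerivAt_id z).const_sub 1).const_mul 6
  refine ((hasDerivAt_one_sub_rpow hz1).mul ((hasDerivAt_hyp' hz).sub
    ((hasDerivAt_hyp hz).div h2 (by simpa using h1)))).congr_deriv ?_
  rw [riemannProfile'']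
  simp only [Pi.div_apply, Pi.sub_apply]
  field_simp
  ring

/-- The factor `(1 - z)^(1/6)` turns the hypergeometric equation into the one that makes
`riemannProfile ∘ riemannArg` a solution of the adjoint equation in `u, v`. -/
theorem riemannProfile_ode {z : ℝ} (hz : |z| < 1) :
    z * riemannProfile'' z + riemannProfile' z + 5 / 36 * riemannProfile z / (1 - z) ^ 2 = 0 := by
  have hz1 := (abs_lt.1 hz).2
  have h1 : 1 - z ≠ 0 := by linarith
  rw [riemannProfile, riemannProfile', riemannProfile'']
  have := hyp_ode hz
  field_simp
  field_simp at this
  linear_combination 6 * (1 - z) * (1 - z) ^ (1 / 6 : ℝ) * this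

theorem riemannProfile_zero : riemannProfile 0 = 1 := by
  simp [riemannProfile, hyp_zero]

theorem exists_abs_riemannProfile_le : ∃ A : ℝ, 0 < A ∧ ∀ z : ℝ, 0 ≤ z → z < 1 →
    |riemannProfile z| ≤ A * (1 - z) ^ (1 / 6 : ℝ) := by
  obtain ⟨A, hA, h⟩ := exists_abs_hyp_le
  refine ⟨A, hA, fun z h0 h1 => ?_⟩
  have : 0 ≤ (1 - z) ^ (1 / 6 : ℝ) := Real.rpow_nonneg (by linarith) _
  rw [riemannProfile, abs_mul, abs_of_nonneg this, mul_comm]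
  gcongr
  exact h z h0 h1

/-! ### Riemann's method in characteristic coordinates -/

/-- The argument of the Riemann function with pole `(U, V)`, in characteristic coordinates. -/
noncomputable def riemannArg (U V u v : ℝ) : ℝ := (U - u) * (V - v) / ((U + v) * (V + u))

section RiemannArg

variable {U V u v : ℝ}

theorem one_sub_riemannArg (h1 : 0 < U + v) (h2 : 0 < V + u) :
    1 - riemannArg U V u v = (U + V) * (u + v) / ((U + v) * (V + u)) := by
  rw [riemannArg]; field_simp; ring

theorem riemannArg_nonneg (hu : u ≤ U) (hv : v ≤ V) (h : 0 < u + v) :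
    0 ≤ riemannArg U V u v := by
  have h1 : 0 < U + v := by linarith
  have h2 : 0 < V + u := by linarith
  have h3 : 0 ≤ U - u := by linarith
  have h4 : 0 ≤ V - v := by linarith
  rw [riemannArg]; positivity

theorem riemannArg_lt_one (hu : u ≤ U) (hv : v ≤ V) (h : 0 < u + v) :
    riemannArg U V u v < 1 := by
  have h1 : 0 < U + v := by linarith
  have h2 : 0 < V + u := by linarith
  have h3 : 0 < U + V := by linarith
  have := one_sub_riemannArg h1 h2
  have h5 : 0 < (U + V) * (u + v) / ((U + v) * (V + u)) := by positivity
  linarith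

theorem abs_riemannArg_lt_one (hu : u ≤ U) (hv : v ≤ V) (h : 0 < u + v) :
    |riemannArg U V u v| < 1 := by
  rw [abs_of_nonneg (riemannArg_nonneg hu hv h)]
  exact riemannArg_lt_one hu hv h

theorem hasDerivAt_sub_div_add (h : 0 < V + u) :
    HasDerivAt (fun u => (U - u) / (V + u)) (-(U + V) / (V + u) ^ 2) u := by
  refine (((hasDerivAt_id u).const_sub U).div ((hasDerivAt_id u).const_add V)
    h.ne').congr_deriv ?_
  simp only [id]
  congr 1
  ring

theorem hasDerivAt_riemannArg_left (h : 0 < V + u) :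
    HasDerivAt (fun u => riemannArg U V u v)
      (-(U + V) / (V + u) ^ 2 * ((V - v) / (U + v))) u := by
  have := (hasDerivAt_sub_div_add (U := U) h).mul_const ((V - v) / (U + v))
  refine this.congr_of_eventuallyEq (Filter.Eventually.of_forall fun x => ?_)
  simp only [riemannArg]
  rw [div_mul_div_comm, mul_comm (V + x)]

theorem hasDerivAt_riemannArg_right (h : 0 < U + v) :
    HasDerivAt (fun v => riemannArg U V u v)
      (-(U + V) / (U + v) ^ 2 * ((U - u) / (V + u))) v := by
  have := (hasDerivAt_sub_div_add (U := V) h).mul_const ((U - u) / (V + u))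
  rw [add_comm V U] at this
  refine this.congr_of_eventuallyEq (Filter.Eventually.of_forall fun x => ?_)
  simp only [riemannArg]
  rw [div_mul_div_comm, mul_comm (V - x)]

/-- The Riemann function with pole `(U, V)`, in characteristic coordinates. -/
noncomputable def riemannFn (U V u v : ℝ) : ℝ := riemannProfile (riemannArg U V u v)

/-- The derivative of the Riemann function in its third argument. -/
noncomputable def riemannFnDeriv (U V u v : ℝ) : ℝ :=
  riemannProfile' (riemannArg U V u v) * (-(U + V) / (V + u) ^ 2 * ((V - v) / (U + v)))

theorem hasDerivAt_riemannFn (hu : u ≤ U) (hv : v ≤ V) (h : 0 < u + v) :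
    HasDerivAt (fun u => riemannFn U V u v) (riemannFnDeriv U V u v) u :=
  (hasDerivAt_riemannProfile (abs_riemannArg_lt_one hu hv h)).comp u
    (hasDerivAt_riemannArg_left (by linarith))

/-- The chain rule reduces this to `riemannProfile_ode` times `(U+V)² / ((U+v)(V+u))²`; the
coefficient of the undifferentiated term comes out right by `one_sub_riemannArg`. -/
theorem hasDerivAt_riemannFnDeriv (hu : u ≤ U) (hv : v ≤ V) (h : 0 < u + v) :
    HasDerivAt (fun v => riemannFnDeriv U V u v)
      (-(5 / 36 / (u + v) ^ 2) * riemannFn U V u v) v := by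
  have h1 : 0 < U + v := by linarith
  have h2 : 0 < V + u := by linarith
  have h3 : 0 < U + V := by linarith
  have hz := abs_riemannArg_lt_one hu hv h
  have ode := riemannProfile_ode hz
  rw [one_sub_riemannArg h1 h2] at ode
  refine (((hasDerivAt_riemannProfile' hz).comp v (hasDerivAt_riemannArg_right h1)).mul
    ((hasDerivAt_sub_div_add (U := V) h1).const_mul (-(U + V) / (V + u) ^ 2))).congr_deriv ?_
  have e : riemannArg U V u v = (U - u) * (V - v) / ((U + v) * (V + u)) := rfl
  simp only [Function.comp_apply, riemannFn]
  generalize riemannProfile (riemannArg U V u v) = a at *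
  generalize riemannProfile' (riemannArg U V u v) = b at *
  generalize riemannProfile'' (riemannArg U V u v) = d at *
  rw [e] at ode
  have ode' := congrArg (fun x => (U + V) ^ 2 / ((U + v) * (V + u)) ^ 2 * x) ode
  simp only [mul_zero] at ode'
  rw [← sub_eq_zero, ← ode']
  field_simp
  ring

theorem continuousAt_riemannArg (h1 : 0 < U + v) (h2 : 0 < V + u) :
    ContinuousAt (fun p : ℝ × ℝ => riemannArg U V p.1 p.2) (u, v) := by
  have : (U + v) * (V + u) ≠ 0 := by positivity
  unfold riemannArg
  exact ContinuousAt.div (by fun_prop) (by fun_prop) this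

theorem continuousAt_riemannFn (hu : u ≤ U) (hv : v ≤ V) (h : 0 < u + v) :
    ContinuousAt (fun p : ℝ × ℝ => riemannFn U V p.1 p.2) (u, v) :=
  ContinuousAt.comp (f := fun p : ℝ × ℝ => riemannArg U V p.1 p.2) (g := riemannProfile)
    (hasDerivAt_riemannProfile (abs_riemannArg_lt_one hu hv h)).continuousAt
    (continuousAt_riemannArg (by linarith) (by linarith))

theorem continuousAt_riemannFnDeriv (hu : u ≤ U) (hv : v ≤ V) (h : 0 < u + v) :
    ContinuousAt (fun p : ℝ × ℝ => riemannFnDeriv U V p.1 p.2) (u, v) := by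
  have h1 : 0 < U + v := by linarith
  have h2 : 0 < V + u := by linarith
  refine ContinuousAt.mul (ContinuousAt.comp (f := fun p : ℝ × ℝ => riemannArg U V p.1 p.2)
    (g := riemannProfile')
    (hasDerivAt_riemannProfile' (abs_riemannArg_lt_one hu hv h)).continuousAt
    (continuousAt_riemannArg (by linarith) (by linarith))) ?_
  refine ContinuousAt.mul (f := fun p : ℝ × ℝ => -(U + V) / (V + p.1) ^ 2)
    (g := fun p : ℝ × ℝ => (V - p.2) / (U + p.2)) ?_ ?_
  · exact ContinuousAt.div (by fun_prop) (by fun_prop) (by positivity)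
  · exact ContinuousAt.div (by fun_prop) (by fun_prop) h1.ne'

end RiemannArg

/-- The Riemann function is controlled only for `u + v > 0`, while the integration rectangle crosses
that line. The other factor vanishes on a neighbourhood of `u + v ≤ 0`, so the values of `k` there
are irrelevant. -/
theorem continuousOn_mul_of_eq_zero {k γ : ℝ × ℝ → ℝ} {c : ℝ} {Q : Set (ℝ × ℝ)} (hc : 0 < c)
    (hk : ∀ p ∈ Q, 0 < p.1 + p.2 → ContinuousAt k p) (hγ : Continuous γ)
    (h0 : ∀ p : ℝ × ℝ, p.1 + p.2 < c → γ p = 0) : ContinuousOn (fun p => k p * γ p) Q := by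
  intro p hp
  refine ContinuousAt.continuousWithinAt ?_
  rcases lt_or_ge 0 (p.1 + p.2) with h | h
  · exact (hk p hp h).mul hγ.continuousAt
  · have : ∀ᶠ x : ℝ × ℝ in nhds p, x.1 + x.2 < c :=
      (continuous_fst.add continuous_snd).continuousAt.eventually_lt continuousAt_const
        (by simpa using h.trans_lt hc)
    refine (continuousAt_const (y := (0 : ℝ))).congr ?_
    filter_upwards [this] with x hx
    rw [h0 x hx, mul_zero]

theorem hasDerivAt_mul_of_eq_zero {k γ : ℝ → ℝ} {k' γ' s c x : ℝ} (hc : 0 < c)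
    (hk : 0 < s + x → HasDerivAt k k' x) (hγ : HasDerivAt γ γ' x)
    (h0 : ∀ y, s + y < c → γ y = 0) : HasDerivAt (fun y => k y * γ y) (k' * γ x + k x * γ') x := by
  rcases lt_or_ge 0 (s + x) with h | h
  · exact (hk h).mul hγ
  · have hev : ∀ᶠ y : ℝ in nhds x, s + y < c :=
      (continuous_const.add continuous_id).continuousAt.eventually_lt continuousAt_const
        (by simpa using h.trans_lt hc)
    have hγ0 : γ' = 0 := hγ.unique ((hasDerivAt_const x (0 : ℝ)).congr_of_eventuallyEq
      (by filter_upwards [hev] with y hy using h0 y hy))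
    rw [hγ0, h0 x (h.trans_lt hc), mul_zero, mul_zero, add_zero]
    refine (hasDerivAt_const x (0 : ℝ)).congr_of_eventuallyEq ?_
    filter_upwards [hev] with y hy
    rw [h0 y hy, mul_zero]

/-- Riemann's representation formula: a function `g` that vanishes near and below the line
`u + v = 0` is recovered from `g_{uv} + (5/36) (u + v)⁻² g`. -/
theorem riemann_representation {U V c : ℝ} (hUV : 0 < U + V) (hc : 0 < c)
    {g gv guv : ℝ × ℝ → ℝ}
    (hg : ∀ u v, HasDerivAt (fun v => g (u, v)) (gv (u, v)) v)
    (hgv : ∀ u v, HasDerivAt (fun u => gv (u, v)) (guv (u, v)) u)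
    (cg : Continuous g) (cgv : Continuous gv) (cguv : Continuous guv)
    (zg : ∀ p : ℝ × ℝ, p.1 + p.2 < c → g p = 0)
    (zgv : ∀ p : ℝ × ℝ, p.1 + p.2 < c → gv p = 0)
    (zguv : ∀ p : ℝ × ℝ, p.1 + p.2 < c → guv p = 0) :
    g (U, V) = ∫ p in Icc (-V) U ×ˢ Icc (-U) V,
      riemannFn U V p.1 p.2 * (guv p + 5 / 36 / (p.1 + p.2) ^ 2 * g p) := by
  set Q : Set (ℝ × ℝ) := Icc (-V) U ×ˢ Icc (-U) V with hQ
  have hQc : IsCompact Q := isCompact_Icc.prod isCompact_Icc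
  have c1 : ContinuousOn (fun p : ℝ × ℝ => riemannFnDeriv U V p.1 p.2 * gv p) Q :=
    continuousOn_mul_of_eq_zero hc
      (fun p hp h => continuousAt_riemannFnDeriv hp.1.2 hp.2.2 h) cgv zgv
  have c2 : ContinuousOn (fun p : ℝ × ℝ => riemannFn U V p.1 p.2 * guv p) Q :=
    continuousOn_mul_of_eq_zero hc
      (fun p hp h => continuousAt_riemannFn hp.1.2 hp.2.2 h) cguv zguv
  have c3 : ContinuousOn (fun p : ℝ × ℝ =>
      (-(5 / 36 / (p.1 + p.2) ^ 2) * riemannFn U V p.1 p.2) * g p) Q :=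
    continuousOn_mul_of_eq_zero hc
      (fun p hp h => by
        refine ContinuousAt.mul (ContinuousAt.neg (ContinuousAt.div (by fun_prop) (by fun_prop) ?_))
          (continuousAt_riemannFn hp.1.2 hp.2.2 h)
        positivity) cg zg
  have c4 : ContinuousOn (fun p : ℝ × ℝ => riemannFnDeriv U V p.1 p.2 * g p) Q :=
    continuousOn_mul_of_eq_zero hc
      (fun p hp h => continuousAt_riemannFnDeriv hp.1.2 hp.2.2 h) cg zg
  have c5 : ContinuousOn (fun p : ℝ × ℝ => riemannFn U V p.1 p.2 * gv p) Q :=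
    continuousOn_mul_of_eq_zero hc
      (fun p hp h => continuousAt_riemannFn hp.1.2 hp.2.2 h) cgv zgv
  have i1 := (c1.add c2).integrableOn_compact hQc (μ := volume)
  have i2 := (c3.add c1).integrableOn_compact hQc (μ := volume)
  have sliceu : ∀ v ∈ Icc (-U) V, ∀ k : ℝ × ℝ → ℝ, ContinuousOn k Q →
      ContinuousOn (fun u => k (u, v)) (Icc (-V) U) := fun v hv k hk =>
    hk.comp (f := fun u : ℝ => (u, v)) (by fun_prop) fun u hu => ⟨hu, hv⟩
  have slicev : ∀ u ∈ Icc (-V) U, ∀ k : ℝ × ℝ → ℝ, ContinuousOn k Q →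
      ContinuousOn (fun v => k (u, v)) (Icc (-U) V) := fun u hu k hk =>
    hk.comp (f := fun v : ℝ => (u, v)) (by fun_prop) fun v hv => ⟨hu, hv⟩
  have leu : -V ≤ U := by linarith
  have lev : -U ≤ V := by linarith
  -- With `R` the Riemann function, the integrand is `∂_u (R g_v)`, and that of `I2` is `∂_v (R_u
  -- g)`. The terms `R_u g_v` cancel in the difference and leave `R g_uv - R_uv g`.
  have I1 : ∫ p in Q, (riemannFnDeriv U V p.1 p.2 * gv p + riemannFn U V p.1 p.2 * guv p)
      = g (U, V) := by
    rw [hQ, Measure.volume_eq_prod, ← setIntegral_prod_swap, setIntegral_prod]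
    rotate_left
    · have := i1.swap
      rwa [← Measure.volume_eq_prod] at this ⊢
    have inner : ∀ v ∈ Icc (-U) V, ∫ u in Icc (-V) U,
        (riemannFnDeriv U V u v * gv (u, v) + riemannFn U V u v * guv (u, v)) = gv (U, v) := by
      intro v hv
      rw [integral_Icc_eq_integral_Ioc, ← intervalIntegral.integral_of_le leu,
        intervalIntegral.integral_eq_sub_of_hasDerivAt_of_le leu
          (f := fun u => riemannFn U V u v * gv (u, v)) (sliceu v hv _ c5)
          (fun u hu => hasDerivAt_mul_of_eq_zero (s := v) hc
            (fun h => hasDerivAt_riemannFn hu.2.le hv.2 (by linarith)) (hgv u v)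
            (fun y hy => zgv _ (by simpa [add_comm] using hy)))]
      -- On the edge `u = -V` one has `u + v ≤ 0`, where `gv` vanishes. On `u = U` the argument of
      -- the profile is zero, so the Riemann function equals `1`.
      · rw [zgv (-V, v) (by simp only; linarith [hv.2])]
        rcases lt_or_ge 0 (U + v) with h | h
        · rw [riemannFn, riemannArg]; simp [riemannProfile_zero]
        · rw [zgv (U, v) (by simp only; linarith)]; simp
      · rw [intervalIntegrable_iff_integrableOn_Icc_of_le leu]
        exact (sliceu v hv _ (c1.add c2)).integrableOn_compact isCompact_Icc
    simp only [Prod.swap_prod_mk]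
    rw [setIntegral_congr_fun measurableSet_Icc inner, integral_Icc_eq_integral_Ioc,
      ← intervalIntegral.integral_of_le lev,
      intervalIntegral.integral_eq_sub_of_hasDerivAt (f := fun v => g (U, v))
        (fun v _ => hg U v), zg (U, -U) (by simpa using hc), sub_zero]
    exact (cgv.comp (by fun_prop : Continuous fun v : ℝ => (U, v))).intervalIntegrable _ _
  have I2 : ∫ p in Q, ((-(5 / 36 / (p.1 + p.2) ^ 2) * riemannFn U V p.1 p.2) * g p
      + riemannFnDeriv U V p.1 p.2 * gv p) = 0 := by
    rw [hQ, Measure.volume_eq_prod, setIntegral_prod]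
    rotate_left
    · rwa [← Measure.volume_eq_prod]
    have inner : ∀ u ∈ Icc (-V) U, ∫ v in Icc (-U) V,
        ((-(5 / 36 / (u + v) ^ 2) * riemannFn U V u v) * g (u, v)
      + riemannFnDeriv U V u v * gv (u, v)) = 0 := by
      intro u hu
      rw [integral_Icc_eq_integral_Ioc, ← intervalIntegral.integral_of_le lev,
        intervalIntegral.integral_eq_sub_of_hasDerivAt_of_le lev
          (f := fun v => riemannFnDeriv U V u v * g (u, v)) (slicev u hu _ c4)
          (fun v hv => hasDerivAt_mul_of_eq_zero (s := u) hc
            (fun h => hasDerivAt_riemannFnDeriv hu.2 hv.2.le h) (hg u v)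
            (fun y hy => zg _ hy))]
      -- At `v = V` the factor `V - v` kills `riemannFnDeriv`; at `v = -U` the function `g`
      -- vanishes.
      · rw [zg (u, -U) (by simp only; linarith [hu.2])]
        simp [riemannFnDeriv]
      · rw [intervalIntegrable_iff_integrableOn_Icc_of_le lev]
        exact (slicev u hu _ (c3.add c1)).integrableOn_compact isCompact_Icc
    rw [setIntegral_congr_fun measurableSet_Icc inner]
    simp
  rw [← I1, ← sub_zero (∫ p in Q, _), ← I2]
  refine (integral_sub i1 i2).symm.trans
    (integral_congr_ae (Filter.Eventually.of_forall fun p => ?_))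
  simp only [Pi.add_apply]
  ring

/-! ### The Tricomi equation in characteristic coordinates -/

theorem tricomiPhi_nonneg {t : ℝ} (ht : 0 ≤ t) : 0 ≤ tricomiPhi t := by
  rw [tricomiPhi]; positivity

theorem tricomiPhi_pos {t : ℝ} (ht : 0 < t) : 0 < tricomiPhi t := by
  rw [tricomiPhi]; positivity

theorem tricomiPhi_lt {s t : ℝ} (hs : 0 ≤ s) (h : s < t) : tricomiPhi s < tricomiPhi t := by
  rw [tricomiPhi, tricomiPhi]
  have := Real.rpow_lt_rpow hs h (z := 3 / 2) (by norm_num)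
  linarith

theorem tricomiPhi_le {s t : ℝ} (hs : 0 ≤ s) (h : s ≤ t) : tricomiPhi s ≤ tricomiPhi t := by
  rcases h.eq_or_lt with rfl | h
  · rfl
  · exact (tricomiPhi_lt hs h).le

theorem lt_of_tricomiPhi_lt {s t : ℝ} (ht : 0 ≤ t) (h : tricomiPhi s < tricomiPhi t) : s < t := by
  by_contra! hc
  exact absurd (tricomiPhi_le ht hc) h.not_ge

theorem continuous_tricomiPhi : Continuous tricomiPhi :=
  (Real.continuous_rpow_const (by norm_num)).const_mul _

theorem hasDerivAt_tricomiPhi (t : ℝ) : HasDerivAt tricomiPhi (t ^ (1 / 2 : ℝ)) t := by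
  refine ((Real.hasDerivAt_rpow_const (x := t) (p := 3 / 2)
    (Or.inr (by norm_num))).const_mul (2 / 3)).congr_deriv ?_
  norm_num
  ring

/-- The inverse function of `tricomiPhi` on `[0, ∞)`, extended by zero. -/
noncomputable def tricomiTime (τ : ℝ) : ℝ := (3 / 2 * max τ 0) ^ (2 / 3 : ℝ)

theorem tricomiTime_pos {τ : ℝ} (h : 0 < τ) : 0 < tricomiTime τ := by
  rw [tricomiTime, max_eq_left h.le]; positivity

theorem tricomiTime_phi {t : ℝ} (ht : 0 ≤ t) : tricomiTime (tricomiPhi t) = t := by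
  rw [tricomiTime, max_eq_left (tricomiPhi_nonneg ht), tricomiPhi, ← mul_assoc]
  norm_num
  rw [← Real.rpow_mul ht]
  norm_num

theorem tricomiPhi_time {τ : ℝ} (h : 0 ≤ τ) : tricomiPhi (tricomiTime τ) = τ := by
  rw [tricomiTime, max_eq_left h, tricomiPhi, ← Real.rpow_mul (by positivity)]
  norm_num
  ring

theorem tricomiTime_lt {τ t : ℝ} (ht : 0 < t) (h : τ < tricomiPhi t) : tricomiTime τ < t := by
  rcases le_or_gt 0 τ with h0 | h0
  · exact lt_of_tricomiPhi_lt ht.le (by rwa [tricomiPhi_time h0])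
  · rw [tricomiTime, max_eq_right h0.le]
    simpa using ht

/-- The derivative of `tricomiTime`. -/
noncomputable def tricomiTimeDeriv (τ : ℝ) : ℝ := (3 / 2 * τ) ^ (-1 / 3 : ℝ)

theorem hasDerivAt_tricomiTime {τ : ℝ} (h : 0 < τ) :
    HasDerivAt tricomiTime (tricomiTimeDeriv τ) τ := by
  have h1 : HasDerivAt (fun τ : ℝ => (3 / 2 * τ) ^ (2 / 3 : ℝ)) (tricomiTimeDeriv τ) τ := by
    refine (((hasDerivAt_id τ).const_mul (3 / 2)).rpow_const (p := 2 / 3)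
      (Or.inl (by simpa using h.ne'))).congr_deriv ?_
    rw [tricomiTimeDeriv]
    norm_num
  refine h1.congr_of_eventuallyEq ?_
  filter_upwards [lt_mem_nhds h] with x hx
  rw [tricomiTime, max_eq_left hx.le]

theorem hasDerivAt_tricomiTimeDeriv {τ : ℝ} (h : 0 < τ) :
    HasDerivAt tricomiTimeDeriv (-tricomiTimeDeriv τ / (3 * τ)) τ := by
  have h1 : 0 < 3 / 2 * τ := by positivity
  refine (((hasDerivAt_id τ).const_mul (3 / 2)).rpow_const (p := -1 / 3)
      (Or.inl (by simpa using h.ne'))).congr_deriv ?_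
  simp only [id]
  rw [tricomiTimeDeriv, Real.rpow_sub h1, Real.rpow_one]
  field_simp

/-- Since `φ'(t)² = t`, the inverse function has squared derivative `1/t`; this turns `T'² W_tt -
W_xx` into `(W_tt - t W_xx) / t`. -/
theorem tricomiTimeDeriv_sq {τ : ℝ} (h : 0 < τ) :
    tricomiTimeDeriv τ ^ 2 = (tricomiTime τ)⁻¹ := by
  rw [tricomiTime, max_eq_left h.le, tricomiTimeDeriv, ← Real.rpow_neg (by positivity),
    ← Real.rpow_natCast, ← Real.rpow_mul (by positivity)]
  norm_num

theorem hasDerivAt_rpow_one_sixth {τ : ℝ} (h : 0 < τ) :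
    HasDerivAt (fun τ : ℝ => τ ^ (1 / 6 : ℝ)) (τ ^ (1 / 6 : ℝ) / (6 * τ)) τ := by
  refine (Real.hasDerivAt_rpow_const (p := 1 / 6) (Or.inl h.ne')).congr_deriv ?_
  rw [Real.rpow_sub h, Real.rpow_one]
  field_simp

/-- `f` has partial derivatives `a` and `b`, and is differentiable. -/
def HasPartials (f a b : ℝ × ℝ → ℝ) : Prop :=
  ∀ z, HasFDerivAt f (a z • ContinuousLinearMap.fst ℝ ℝ ℝ + b z • ContinuousLinearMap.snd ℝ ℝ ℝ) z

theorem HasPartials.continuous {f a b : ℝ × ℝ → ℝ} (h : HasPartials f a b) : Continuous f :=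
  continuous_iff_continuousAt.2 fun z => (h z).continuousAt

theorem HasPartials.comp {f a b : ℝ × ℝ → ℝ} (h : HasPartials f a b) {X Y : ℝ → ℝ} {X' Y' s : ℝ}
    (hX : HasDerivAt X X' s) (hY : HasDerivAt Y Y' s) :
    HasDerivAt (fun s => f (X s, Y s)) (a (X s, Y s) * X' + b (X s, Y s) * Y') s := by
  refine ((h (X s, Y s)).comp_hasDerivAt s (hX.prodMk hY)).congr_deriv ?_
  simp

/-- The pullback of a function of `(t, x)` to the characteristic coordinates. -/
noncomputable def charPullback (f : ℝ × ℝ → ℝ) (p : ℝ × ℝ) : ℝ :=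
  f (tricomiTime ((p.1 + p.2) / 2), (p.1 - p.2) / 2)

theorem charPullback_eq_zero {f : ℝ × ℝ → ℝ} {δ : ℝ} (hδ : 0 < δ)
    (hf : ∀ z : ℝ × ℝ, z.1 < δ → f z = 0) {p : ℝ × ℝ} (hp : p.1 + p.2 < 2 * tricomiPhi δ) :
    charPullback f p = 0 :=
  hf _ (tricomiTime_lt hδ (by linarith))

theorem continuousAt_charPullback {f : ℝ × ℝ → ℝ} (hf : Continuous f) {p : ℝ × ℝ}
    (hp : 0 < p.1 + p.2) : ContinuousAt (charPullback f) p := by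
  have h1 : ContinuousAt (fun p : ℝ × ℝ => tricomiTime ((p.1 + p.2) / 2)) p :=
    ContinuousAt.comp (f := fun p : ℝ × ℝ => (p.1 + p.2) / 2)
      (hasDerivAt_tricomiTime (by positivity)).continuousAt (by fun_prop)
  exact hf.continuousAt.comp (h1.prodMk (by fun_prop))

theorem HasPartials.hasDerivAt_charPullback_left {f a b : ℝ × ℝ → ℝ} (h : HasPartials f a b)
    {u v : ℝ} (hp : 0 < u + v) :
    HasDerivAt (fun u => charPullback f (u, v))
      (tricomiTimeDeriv ((u + v) / 2) / 2 * charPullback a (u, v)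
        + charPullback b (u, v) / 2) u := by
  have h1 : HasDerivAt (fun u => tricomiTime ((u + v) / 2))
      (tricomiTimeDeriv ((u + v) / 2) * (1 / 2)) u :=
    HasDerivAt.comp u (h := fun u => (u + v) / 2) (hasDerivAt_tricomiTime (by positivity))
      (((hasDerivAt_id u).add_const v).div_const 2)
  refine (h.comp h1 (((hasDerivAt_id u).sub_const v).div_const 2)).congr_deriv ?_
  simp only [charPullback, id]
  ring

theorem HasPartials.hasDerivAt_charPullback_right {f a b : ℝ × ℝ → ℝ} (h : HasPartials f a b)
    {u v : ℝ} (hp : 0 < u + v) :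
    HasDerivAt (fun v => charPullback f (u, v))
      (tricomiTimeDeriv ((u + v) / 2) / 2 * charPullback a (u, v)
        - charPullback b (u, v) / 2) v := by
  have h1 : HasDerivAt (fun v => tricomiTime ((u + v) / 2))
      (tricomiTimeDeriv ((u + v) / 2) * (1 / 2)) v :=
    HasDerivAt.comp v (h := fun v => (u + v) / 2) (hasDerivAt_tricomiTime (by positivity))
      (((hasDerivAt_id v).const_add u).div_const 2)
  refine (h.comp h1 (((hasDerivAt_id v).const_sub u).div_const 2)).congr_deriv ?_
  simp only [charPullback, id]
  ring

theorem continuous_of_eq_zero {γ : ℝ × ℝ → ℝ} {c : ℝ} (hc : 0 < c)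
    (hk : ∀ p : ℝ × ℝ, 0 < p.1 + p.2 → ContinuousAt γ p)
    (h0 : ∀ p : ℝ × ℝ, p.1 + p.2 < c → γ p = 0) : Continuous γ := by
  refine continuous_iff_continuousAt.2 fun p => ?_
  rcases lt_or_ge 0 (p.1 + p.2) with h | h
  · exact hk p h
  · have : ∀ᶠ x : ℝ × ℝ in nhds p, x.1 + x.2 < c :=
      (continuous_fst.add continuous_snd).continuousAt.eventually_lt continuousAt_const
        (by simpa using h.trans_lt hc)
    refine (continuousAt_const (y := (0 : ℝ))).congr ?_
    filter_upwards [this] with x hx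
    rw [h0 x hx]

theorem hasDerivAt_of_eq_zero {γ : ℝ → ℝ} {γ' s c x : ℝ} (hc : 0 < c)
    (hγ : 0 < s + x → HasDerivAt γ γ' x) (h0 : ∀ y, s + y < c → γ y = 0)
    (h0' : s + x < c → γ' = 0) : HasDerivAt γ γ' x := by
  rcases lt_or_ge 0 (s + x) with h | h
  · exact hγ h
  · have hev : ∀ᶠ y : ℝ in nhds x, s + y < c :=
      (continuous_const.add continuous_id).continuousAt.eventually_lt continuousAt_const
        (by simpa using h.trans_lt hc)
    rw [h0' (h.trans_lt hc)]
    refine (hasDerivAt_const x (0 : ℝ)).congr_of_eventuallyEq ?_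
    filter_upwards [hev] with y hy
    rw [h0 y hy]

/-- Riemann's formula for a function of `(t, x)` that vanishes for small times. -/
theorem tricomi_riemann_representation {W Wt Wx Wtt Wtx Wxx : ℝ × ℝ → ℝ} {δ : ℝ} (hδ : 0 < δ)
    (hW : HasPartials W Wt Wx) (hWt : HasPartials Wt Wtt Wtx) (hWx : HasPartials Wx Wtx Wxx)
    (ctt : Continuous Wtt) (cxx : Continuous Wxx)
    (z : ∀ z : ℝ × ℝ, z.1 < δ → W z = 0) (zt : ∀ z : ℝ × ℝ, z.1 < δ → Wt z = 0)
    (zx : ∀ z : ℝ × ℝ, z.1 < δ → Wx z = 0) (ztt : ∀ z : ℝ × ℝ, z.1 < δ → Wtt z = 0)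
    (zxx : ∀ z : ℝ × ℝ, z.1 < δ → Wxx z = 0) {U V : ℝ} (hUV : 0 < U + V) :
    ((U + V) / 2) ^ (1 / 6 : ℝ) * charPullback W (U, V) =
      ∫ p in Ioo (-V) U ×ˢ Ioo (-U) V, riemannFn U V p.1 p.2 *
        (((p.1 + p.2) / 2) ^ (1 / 6 : ℝ) / (4 * tricomiTime ((p.1 + p.2) / 2)) *
          charPullback (fun z => Wtt z - z.1 * Wxx z) p) := by
  set c := 2 * tricomiPhi δ with hc_def
  have hc : 0 < c := by have := tricomiPhi_pos hδ; positivity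
  have pz := fun {f : ℝ × ℝ → ℝ} (hf : ∀ z : ℝ × ℝ, z.1 < δ → f z = 0) {p : ℝ × ℝ}
    (hp : p.1 + p.2 < c) => charPullback_eq_zero hδ hf hp
  -- The exponent `1/6` is the one for which the terms in `Wt` cancel in `guv`; the zeroth-order
  -- term left over is `-(5/36)(u+v)⁻² g`.
  set m : ℝ × ℝ → ℝ := fun p => ((p.1 + p.2) / 2) ^ (1 / 6 : ℝ) with hm
  set T1 : ℝ × ℝ → ℝ := fun p => tricomiTimeDeriv ((p.1 + p.2) / 2) with hT1
  set g : ℝ × ℝ → ℝ := fun p => m p * charPullback W p with hg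
  set gv : ℝ × ℝ → ℝ := fun p => m p / 2 * (charPullback W p / (3 * (p.1 + p.2))
    + T1 p * charPullback Wt p - charPullback Wx p) with hgv
  set guv : ℝ × ℝ → ℝ := fun p => m p / 4 * (T1 p ^ 2 * charPullback Wtt p - charPullback Wxx p
    - 5 / 9 / (p.1 + p.2) ^ 2 * charPullback W p) with hguv
  have cm : ∀ p : ℝ × ℝ, 0 < p.1 + p.2 → ContinuousAt m p := fun p hp =>
    ContinuousAt.comp (f := fun p : ℝ × ℝ => (p.1 + p.2) / 2) (g := fun τ : ℝ => τ ^ (1 / 6 : ℝ))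
      (hasDerivAt_rpow_one_sixth (by positivity)).continuousAt (by fun_prop)
  have cT1 : ∀ p : ℝ × ℝ, 0 < p.1 + p.2 → ContinuousAt T1 p := fun p hp =>
    ContinuousAt.comp (f := fun p : ℝ × ℝ => (p.1 + p.2) / 2) (g := tricomiTimeDeriv)
      (hasDerivAt_tricomiTimeDeriv (by positivity)).continuousAt (by fun_prop)
  have mu : ∀ u v : ℝ, 0 < u + v → HasDerivAt (fun u => m (u, v)) (m (u, v) / (6 * (u + v))) u := by
    intro u v hp
    refine (HasDerivAt.comp u (h := fun u => (u + v) / 2)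
      (hasDerivAt_rpow_one_sixth (by positivity))
      (((hasDerivAt_id u).add_const v).div_const 2)).congr_deriv ?_
    simp only [hm]
    field_simp
  have mv : ∀ u v : ℝ, 0 < u + v → HasDerivAt (fun v => m (u, v)) (m (u, v) / (6 * (u + v))) v := by
    intro u v hp
    refine (HasDerivAt.comp v (h := fun v => (u + v) / 2)
      (hasDerivAt_rpow_one_sixth (by positivity))
      (((hasDerivAt_id v).const_add u).div_const 2)).congr_deriv ?_
    simp only [hm]
    field_simp
  have T1u : ∀ u v : ℝ, 0 < u + v →
      HasDerivAt (fun u => T1 (u, v)) (-T1 (u, v) / (3 * (u + v))) u := by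
    intro u v hp
    refine (HasDerivAt.comp u (h := fun u => (u + v) / 2)
      (hasDerivAt_tricomiTimeDeriv (by positivity))
      (((hasDerivAt_id u).add_const v).div_const 2)).congr_deriv ?_
    simp only [hT1]
    field_simp
  have zg : ∀ p : ℝ × ℝ, p.1 + p.2 < c → g p = 0 := fun p hp => by
    simp only [hg, pz z hp, mul_zero]
  have zgv : ∀ p : ℝ × ℝ, p.1 + p.2 < c → gv p = 0 := fun p hp => by
    simp only [hgv, pz z hp, pz zt hp, pz zx hp]; simp
  have zguv : ∀ p : ℝ × ℝ, p.1 + p.2 < c → guv p = 0 := fun p hp => by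
    simp only [hguv, pz z hp, pz ztt hp, pz zxx hp]; simp
  have dg : ∀ u v, HasDerivAt (fun v => g (u, v)) (gv (u, v)) v := fun u v =>
    hasDerivAt_of_eq_zero (s := u) hc
      (fun h => ((mv u v h).mul (hW.hasDerivAt_charPullback_right h)).congr_deriv (by
        simp only [hgv, hT1]; field_simp; ring))
      (fun y hy => zg _ hy) (fun hy => zgv _ hy)
  have dgv : ∀ u v, HasDerivAt (fun u => gv (u, v)) (guv (u, v)) u := fun u v =>
    hasDerivAt_of_eq_zero (s := v) hc
      (fun h => by
        rw [add_comm] at h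
        have hlin : HasDerivAt (fun u : ℝ => 3 * (u + v)) 3 u := by
          simpa using ((hasDerivAt_id u).add_const v).const_mul 3
        refine (((mu u v h).div_const 2).mul ((((hW.hasDerivAt_charPullback_left h).div hlin
          (by positivity)).add ((T1u u v h).mul (hWt.hasDerivAt_charPullback_left h))).sub
          (hWx.hasDerivAt_charPullback_left h))).congr_deriv ?_
        simp only [hguv, Pi.add_apply, Pi.sub_apply, Pi.mul_apply, Pi.div_apply]
        have e : tricomiTimeDeriv ((u + v) / 2) = T1 (u, v) := rfl
        rw [e]
        field_simp
        ring)
      (fun y hy => zgv _ (by simpa [add_comm] using hy))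
      (fun hy => zguv _ (by simpa [add_comm] using hy))
  have cW := hW.continuous
  have cWt := hWt.continuous
  have cWx := hWx.continuous
  have cg : Continuous g := continuous_of_eq_zero hc
    (fun p hp => (cm p hp).mul (continuousAt_charPullback cW hp)) zg
  have cgv : Continuous gv := continuous_of_eq_zero hc
    (fun p hp => ((cm p hp).div_const 2).mul ((((continuousAt_charPullback cW hp).div
      (by fun_prop) (by positivity)).add ((cT1 p hp).mul (continuousAt_charPullback cWt hp))).sub
      (continuousAt_charPullback cWx hp))) zgv
  have cguv : Continuous guv := continuous_of_eq_zero hc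
    (fun p hp => ((cm p hp).div_const 4).mul (((((cT1 p hp).pow 2).mul
      (continuousAt_charPullback ctt hp)).sub (continuousAt_charPullback cxx hp)).sub
      (ContinuousAt.mul (ContinuousAt.div (by fun_prop) (by fun_prop) (by positivity))
      (continuousAt_charPullback cW hp)))) zguv
  have main := riemann_representation hUV hc dg dgv cg cgv cguv zg zgv zguv
  have hset : (Ioo (-V) U ×ˢ Ioo (-U) V : Set (ℝ × ℝ)) =ᵐ[volume] Icc (-V) U ×ˢ Icc (-U) V :=
    Measure.set_prod_ae_eq Ioo_ae_eq_Icc Ioo_ae_eq_Icc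
  rw [setIntegral_congr_set hset]
  refine main.trans (integral_congr_ae (Filter.Eventually.of_forall fun p => ?_))
  simp only
  rcases lt_or_ge 0 (p.1 + p.2) with h | h
  · have h1 : T1 p ^ 2 = (tricomiTime ((p.1 + p.2) / 2))⁻¹ := tricomiTimeDeriv_sq (by positivity)
    have h2 : 0 < tricomiTime ((p.1 + p.2) / 2) := tricomiTime_pos (by positivity)
    simp only [hguv, hg, h1]
    simp only [charPullback]
    field_simp
    ring
  · have h' := h.trans_lt hc
    have : charPullback (fun z => Wtt z - z.1 * Wxx z) p = 0 :=
      pz (fun z hz => by rw [ztt z hz, zxx z hz]; simp) h'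
    rw [zg p h', zguv p h', this]
    simp

/-! ### The pointwise bound for solutions that vanish for small times -/

/-- The backward characteristic cone of `z`. -/
def tricomiCone (z : ℝ × ℝ) : Set (ℝ × ℝ) :=
  {ζ | 0 < ζ.1 ∧ |z.2 - ζ.2| < tricomiPhi z.1 - tricomiPhi ζ.1}

/-- `φ(t)` times the distance of `ζ` to the boundary of the backward cone of `z = (t, x)`. -/
noncomputable def coneDist (z ζ : ℝ × ℝ) : ℝ :=
  tricomiPhi z.1 * (tricomiPhi z.1 - tricomiPhi ζ.1 - |z.2 - ζ.2|)

theorem continuous_coneDist : Continuous fun p : (ℝ × ℝ) × (ℝ × ℝ) => coneDist p.1 p.2 := by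
  have := continuous_tricomiPhi
  unfold coneDist
  fun_prop

theorem isOpen_tricomiCone (z : ℝ × ℝ) : IsOpen (tricomiCone z) := by
  have := continuous_tricomiPhi
  exact (isOpen_lt continuous_const continuous_fst).inter
    (isOpen_lt (f := fun ζ : ℝ × ℝ => |z.2 - ζ.2|)
      (g := fun ζ : ℝ × ℝ => tricomiPhi z.1 - tricomiPhi ζ.1) (by fun_prop) (by fun_prop))

/-- The change of variables from `(s, y)` to characteristic coordinates. -/
noncomputable def charMap (ζ : ℝ × ℝ) : ℝ × ℝ := (tricomiPhi ζ.1 + ζ.2, tricomiPhi ζ.1 - ζ.2)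

/-- The derivative of `charMap`. -/
noncomputable def charMapDeriv (ζ : ℝ × ℝ) : ℝ × ℝ →L[ℝ] ℝ × ℝ :=
  (Matrix.toLin (.finTwoProd ℝ) (.finTwoProd ℝ)
    !![ζ.1 ^ (1 / 2 : ℝ), 1; ζ.1 ^ (1 / 2 : ℝ), -1]).toContinuousLinearMap

theorem hasFDerivAt_charMap (ζ : ℝ × ℝ) : HasFDerivAt charMap (charMapDeriv ζ) ζ := by
  unfold charMapDeriv
  rw [Matrix.toLin_finTwoProd_toContinuousLinearMap]
  have h := (hasDerivAt_tricomiPhi ζ.1).comp_hasFDerivAt ζ (hasFDerivAt_fst (𝕜 := ℝ))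
  convert! (h.add hasFDerivAt_snd).prodMk (h.sub hasFDerivAt_snd) using 2
  · simp
  · ext <;> simp [sub_eq_add_neg]

theorem abs_det_charMapDeriv {ζ : ℝ × ℝ} (h : 0 < ζ.1) :
    |(charMapDeriv ζ).det| = 2 * ζ.1 ^ (1 / 2 : ℝ) := by
  unfold charMapDeriv
  simp only [LinearMap.det_toContinuousLinearMap, LinearMap.det_toLin, Matrix.det_fin_two_of]
  have : 0 < ζ.1 ^ (1 / 2 : ℝ) := by positivity
  rw [abs_of_neg (by linarith)]
  ring

theorem injOn_charMap (z : ℝ × ℝ) : InjOn charMap (tricomiCone z) := by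
  rintro ⟨s, y⟩ h ⟨s', y'⟩ h' he
  simp only [charMap, Prod.mk.injEq] at he
  have e1 : tricomiPhi s = tricomiPhi s' := by linarith [he.1, he.2]
  have e2 : y = y' := by linarith [he.1, he.2]
  rw [Prod.mk.injEq]
  refine ⟨?_, e2⟩
  have h1 := tricomiTime_phi h.1.le
  have h2 := tricomiTime_phi h'.1.le
  simp only at h1 h2
  rw [← h1, ← h2, e1]

theorem image_charMap_tricomiCone {t x : ℝ} :
    charMap '' tricomiCone (t, x) = {p : ℝ × ℝ | 0 < p.1 + p.2} ∩
      Ioo (-(tricomiPhi t - x)) (tricomiPhi t + x) ×ˢ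
        Ioo (-(tricomiPhi t + x)) (tricomiPhi t - x) := by
  ext ⟨u, v⟩
  constructor
  · rintro ⟨⟨s, y⟩, ⟨h1, h2⟩, he⟩
    simp only [charMap, Prod.mk.injEq] at he h1 h2
    have := tricomiPhi_pos h1
    rw [abs_lt] at h2
    simp only [mem_inter_iff, mem_ofPred_eq, mem_prod, mem_Ioo]
    refine ⟨?_, ⟨?_, ?_⟩, ?_, ?_⟩ <;> linarith
  · rintro ⟨h0, ⟨h1, h2⟩, h3, h4⟩
    simp only [mem_ofPred_eq] at h0 h1 h2 h3 h4
    refine ⟨(tricomiTime ((u + v) / 2), (u - v) / 2), ⟨tricomiTime_pos (by linarith), ?_⟩, ?_⟩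
    · simp only
      rw [tricomiPhi_time (by linarith), abs_lt]
      constructor <;> linarith
    · simp only [charMap]
      rw [tricomiPhi_time (by linarith)]
      ext <;> simp only <;> ring

/-- The left side is the Jacobian times the kernel in characteristic coordinates. Since `σ^(1/3) ≤
s^(1/2)`, the powers of `s` cancel; the remaining `τ^(1/6)` is the factor on the left of
`tricomi_riemann_representation`. -/
theorem riemann_kernel_le {A τ σ s r P D : ℝ} (hA : 0 < A) (hs : 0 < s) (hτ : 0 < τ)
    (hσ : σ = tricomiPhi s) (hD : 0 < D) (hDP : D ≤ P)
    (hr : |r| ≤ A * (4 * τ * σ / P) ^ (1 / 6 : ℝ)) :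
    2 * s ^ (1 / 2 : ℝ) * (|r| * (σ ^ (1 / 6 : ℝ) / (4 * s))) ≤
      A * τ ^ (1 / 6 : ℝ) * D ^ (-(1 / 6) : ℝ) := by
  have hσ0 : 0 < σ := hσ ▸ tricomiPhi_pos hs
  have hP : 0 < P := hD.trans_le hDP
  have h1 : σ ^ (1 / 6 : ℝ) * σ ^ (1 / 6 : ℝ) ≤ s ^ (1 / 2 : ℝ) := by
    rw [← Real.rpow_add hσ0]
    have : σ ≤ s ^ (3 / 2 : ℝ) := by
      rw [hσ, tricomiPhi]
      have : 0 < s ^ (3 / 2 : ℝ) := by positivity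
      linarith
    calc σ ^ (1 / 6 + 1 / 6 : ℝ) ≤ (s ^ (3 / 2 : ℝ)) ^ (1 / 6 + 1 / 6 : ℝ) :=
          Real.rpow_le_rpow hσ0.le this (by norm_num)
      _ = s ^ (1 / 2 : ℝ) := by rw [← Real.rpow_mul hs.le]; norm_num
  have h2 : s ^ (1 / 2 : ℝ) * s ^ (1 / 2 : ℝ) = s := by
    rw [← Real.rpow_add hs]; norm_num
  have h3 : (4 : ℝ) ^ (1 / 6 : ℝ) ≤ 2 := by
    calc (4 : ℝ) ^ (1 / 6 : ℝ) ≤ (2 ^ (6 : ℝ)) ^ (1 / 6 : ℝ) :=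
          Real.rpow_le_rpow (by norm_num) (by norm_num) (by norm_num)
      _ = 2 := by rw [← Real.rpow_mul (by norm_num)]; norm_num
  have h4 : (4 * τ * σ / P) ^ (1 / 6 : ℝ) ≤
      2 * τ ^ (1 / 6 : ℝ) * σ ^ (1 / 6 : ℝ) * D ^ (-(1 / 6) : ℝ) := by
    calc (4 * τ * σ / P) ^ (1 / 6 : ℝ) ≤ (4 * τ * σ / D) ^ (1 / 6 : ℝ) := by gcongr
      _ = 4 ^ (1 / 6 : ℝ) * τ ^ (1 / 6 : ℝ) * σ ^ (1 / 6 : ℝ) * D ^ (-(1 / 6) : ℝ) := by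
        rw [div_eq_mul_inv, Real.mul_rpow (by positivity) (by positivity),
          Real.mul_rpow (by positivity) (by positivity),
          Real.mul_rpow (by positivity) (by positivity), Real.inv_rpow hD.le, Real.rpow_neg hD.le]
      _ ≤ _ := by gcongr
  calc 2 * s ^ (1 / 2 : ℝ) * (|r| * (σ ^ (1 / 6 : ℝ) / (4 * s)))
      ≤ 2 * s ^ (1 / 2 : ℝ) * (A * (2 * τ ^ (1 / 6 : ℝ) * σ ^ (1 / 6 : ℝ) * D ^ (-(1 / 6) : ℝ))
        * (σ ^ (1 / 6 : ℝ) / (4 * s))) := by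
        gcongr
        exact hr.trans (by gcongr)
    _ = A * τ ^ (1 / 6 : ℝ) * D ^ (-(1 / 6) : ℝ) *
        (s ^ (1 / 2 : ℝ) * (σ ^ (1 / 6 : ℝ) * σ ^ (1 / 6 : ℝ)) / s) := by
        field_simp
        ring
    _ ≤ A * τ ^ (1 / 6 : ℝ) * D ^ (-(1 / 6) : ℝ) *
        (s ^ (1 / 2 : ℝ) * s ^ (1 / 2 : ℝ) / s) := by gcongr
    _ = _ := by rw [h2, div_self hs.ne', mul_one]

/-- A function that vanishes for small times is controlled by `∂ₜ² W - t ∂ₓ² W` through the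
kernel `(coneDist z ζ)^(-1/6)` on the backward cone. -/
theorem exists_enorm_le_lintegral_cone : ∃ A : ℝ, 0 < A ∧
    ∀ (W Wt Wx Wtt Wtx Wxx : ℝ × ℝ → ℝ) (δ : ℝ), 0 < δ →
      HasPartials W Wt Wx → HasPartials Wt Wtt Wtx → HasPartials Wx Wtx Wxx →
      Continuous Wtt → Continuous Wxx →
      (∀ z : ℝ × ℝ, z.1 < δ → W z = 0) → (∀ z : ℝ × ℝ, z.1 < δ → Wt z = 0) →
      (∀ z : ℝ × ℝ, z.1 < δ → Wx z = 0) → (∀ z : ℝ × ℝ, z.1 < δ → Wtt z = 0) →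
      (∀ z : ℝ × ℝ, z.1 < δ → Wxx z = 0) → ∀ z : ℝ × ℝ, 0 < z.1 →
      ‖W z‖ₑ ≤ ENNReal.ofReal A * ∫⁻ ζ in tricomiCone z,
        ENNReal.ofReal (coneDist z ζ ^ (-(1 / 6) : ℝ)) * ‖Wtt ζ - ζ.1 * Wxx ζ‖ₑ := by
  obtain ⟨A, hA, hAr⟩ := exists_abs_riemannProfile_le
  refine ⟨A, hA, ?_⟩
  rintro W Wt Wx Wtt Wtx Wxx δ hδ hW hWt hWx ctt cxx z0 zt zx ztt zxx ⟨t, x⟩ ht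
  simp only at ht
  set τ := tricomiPhi t with hτ
  have hτ0 : 0 < τ := tricomiPhi_pos ht
  have rep := tricomi_riemann_representation hδ hW hWt hWx ctt cxx z0 zt zx ztt zxx
    (U := τ + x) (V := τ - x) (by linarith)
  have e1 : charPullback W (τ + x, τ - x) = W (t, x) := by
    rw [charPullback]
    simp only
    rw [show (τ + x + (τ - x)) / 2 = τ by ring, show (τ + x - (τ - x)) / 2 = x by ring,
      hτ, tricomiTime_phi ht.le]
  rw [e1, show (τ + x + (τ - x)) / 2 = τ by ring] at rep
  set f : ℝ × ℝ → ℝ := fun p => riemannFn (τ + x) (τ - x) p.1 p.2 *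
        (((p.1 + p.2) / 2) ^ (1 / 6 : ℝ) / (4 * tricomiTime ((p.1 + p.2) / 2)) *
          charPullback (fun z => Wtt z - z.1 * Wxx z) p) with hf
  have hτ6 : 0 < τ ^ (1 / 6 : ℝ) := by positivity
  have step1 : ENNReal.ofReal (τ ^ (1 / 6 : ℝ)) * ‖W (t, x)‖ₑ ≤
      ∫⁻ p in charMap '' tricomiCone (t, x), ‖f p‖ₑ := by
    rw [← Real.enorm_of_nonneg hτ6.le, ← enorm_mul, rep, image_charMap_tricomiCone,
      ← setLIntegral_indicator (measurableSet_lt (by fun_prop) (by fun_prop))]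
    refine (enorm_integral_le_lintegral_enorm _).trans (lintegral_mono fun p => ?_)
    -- The image of the cone is only the part of the rectangle with `u + v > 0`; on the rest the
    -- source vanishes.
    by_cases hp : 0 < p.1 + p.2
    · rw [indicator_of_mem (by exact hp)]
    · have : charPullback (fun z => Wtt z - z.1 * Wxx z) p = 0 :=
        charPullback_eq_zero hδ (fun z hz => by rw [ztt z hz, zxx z hz]; simp)
          (by have := tricomiPhi_pos hδ; linarith)
      simp [hf, this]
  have step2 : ∫⁻ p in charMap '' tricomiCone (t, x), ‖f p‖ₑ ≤
      ENNReal.ofReal (τ ^ (1 / 6 : ℝ)) * (ENNReal.ofReal A * ∫⁻ ζ in tricomiCone (t, x),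
        ENNReal.ofReal (coneDist (t, x) ζ ^ (-(1 / 6) : ℝ)) * ‖Wtt ζ - ζ.1 * Wxx ζ‖ₑ) := by
    rw [lintegral_image_eq_lintegral_abs_det_fderiv_mul volume
      (isOpen_tricomiCone _).measurableSet
      (fun ζ _ => (hasFDerivAt_charMap ζ).hasFDerivWithinAt) (injOn_charMap _), ← mul_assoc,
      ← lintegral_const_mul' _ _ (by finiteness)]
    refine setLIntegral_mono' (isOpen_tricomiCone _).measurableSet ?_
    rintro ⟨s, y⟩ ⟨hs, hc⟩
    simp only at hs hc
    set σ := tricomiPhi s with hσ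
    have hσ0 : 0 < σ := tricomiPhi_pos hs
    rw [← hτ] at hc
    have e2 : (charMap (s, y)).1 + (charMap (s, y)).2 = 2 * σ := by simp only [charMap]; ring
    have e3 : charPullback (fun z => Wtt z - z.1 * Wxx z) (charMap (s, y)) =
        Wtt (s, y) - s * Wxx (s, y) := by
      simp only [charPullback]
      rw [e2, show 2 * σ / 2 = σ by ring, hσ, tricomiTime_phi hs.le]
      simp only [charMap]
      rw [show (tricomiPhi s + y - (tricomiPhi s - y)) / 2 = y by ring]
    have habs := abs_lt.1 hc
    have hD : 0 < coneDist (t, x) (s, y) := mul_pos hτ0 (by simp only [← hτ, ← hσ]; linarith)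
    -- The right side is `(τ+σ)² - (x-y)²`. Of its two factors, one is at least `τ` and the other at
    -- least `τ - σ - |x-y|`.
    have hDP : coneDist (t, x) (s, y) ≤ (τ + x + (σ - y)) * (τ - x + (σ + y)) := by
      simp only [coneDist]
      rw [← hτ, ← hσ]
      have h0 := abs_nonneg (x - y)
      have h1 : (τ + x + (σ - y)) * (τ - x + (σ + y)) =
        (τ + σ + |x - y|) * (τ + σ - |x - y|) := by
        linear_combination sq_abs (x - y)
      rw [h1]
      gcongr <;> linarith
    have hr : |riemannFn (τ + x) (τ - x) (σ + y) (σ - y)| ≤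
        A * (4 * τ * σ / ((τ + x + (σ - y)) * (τ - x + (σ + y)))) ^ (1 / 6 : ℝ) := by
      refine (hAr _ (riemannArg_nonneg (by linarith) (by linarith) (by linarith))
        (riemannArg_lt_one (by linarith) (by linarith) (by linarith))).trans (le_of_eq ?_)
      rw [one_sub_riemannArg (by linarith) (by linarith)]
      congr 3
      ring
    have key := riemann_kernel_le hA hs hτ0 hσ hD hDP hr
    have e4 : f (charMap (s, y)) = riemannFn (τ + x) (τ - x) (σ + y) (σ - y) *
        (σ ^ (1 / 6 : ℝ) / (4 * s)) * (Wtt (s, y) - s * Wxx (s, y)) := by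
      simp only [hf, e3, e2]
      rw [show 2 * σ / 2 = σ by ring, ← mul_assoc]
      nth_rewrite 3 [hσ]
      rw [tricomiTime_phi hs.le]
      rfl
    simp only
    rw [e4, enorm_mul, abs_det_charMapDeriv hs, ← mul_assoc, ← mul_assoc]
    refine mul_le_mul' ?_ le_rfl
    rw [Real.enorm_eq_ofReal_abs, ← ENNReal.ofReal_mul (by positivity),
      ← ENNReal.ofReal_mul (by positivity), ← ENNReal.ofReal_mul (by positivity)]
    refine ENNReal.ofReal_le_ofReal ?_
    rw [abs_mul, abs_of_pos (by positivity : 0 < σ ^ (1 / 6 : ℝ) / (4 * s))]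
    calc _ ≤ _ := key
      _ = _ := by ring
  have := step1.trans step2
  rwa [ENNReal.mul_le_mul_iff_right (by simpa using hτ6) (by finiteness)] at this

/-! ### The weighted estimate for the kernel on the cone -/

/-- A Schur-type test for the boundedness of an integral operator from `L^{q'}` to `L^q`. -/
theorem lintegral_kernel_rpow_le {α β : Type*} [MeasurableSpace α] [MeasurableSpace β]
    {μ : Measure α} {ν : Measure β} [SFinite μ] [SFinite ν] {q q' : ℝ} (hq : 2 < q)
    (hqq : q' = q / (q - 1)) {k H₁ H₂ : α → β → ENNReal} {N : β → ENNReal} {B₁ B₂ : ENNReal}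
    (hH₁ : Measurable (Function.uncurry H₁)) (hH₂ : Measurable (Function.uncurry H₂))
    (hN : Measurable N)
    (hk : ∀ z ζ, k z ζ ≤ H₁ z ζ ^ (1 / q) * H₂ z ζ ^ (1 / q) * N ζ)
    (h₁ : ∀ z, ∫⁻ ζ, H₁ z ζ ∂ν ≤ B₁) (h₂ : ∀ ζ, ∫⁻ z, H₂ z ζ ∂μ ≤ B₂) :
    ∫⁻ z, (∫⁻ ζ, k z ζ ∂ν) ^ q ∂μ ≤ B₁ * B₂ * (∫⁻ ζ, N ζ ^ q' ∂ν) ^ (q - 1) := by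
  have hq0 : 0 < q := by linarith
  have hq1 : 0 < q - 1 := by linarith
  have hq'0 : 0 < q' := by rw [hqq]; positivity
  set S := ∫⁻ ζ, N ζ ^ q' ∂ν with hS
  have pt : ∀ z, (∫⁻ ζ, k z ζ ∂ν) ^ q ≤ B₁ * (∫⁻ ζ, H₂ z ζ * N ζ ^ q' ∂ν) * S ^ (q - 2) := by
    intro z
    have m1 : Measurable (H₁ z) := hH₁.of_uncurry_left
    have m2 : Measurable (H₂ z) := hH₂.of_uncurry_left
    -- Hölder with exponents `1/q, 1/q, 1 - 2/q`, the last being nonnegative because `q > 2`. The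
    -- factor `N` splits as `N^(q'/q) N^(q'(1-2/q))`, since `q'(1 - 1/q) = 1`.
    have hol := ENNReal.lintegral_prod_norm_pow_le (μ := ν) (Finset.univ : Finset (Fin 3))
      (f := ![H₁ z, fun ζ => H₂ z ζ * N ζ ^ q', fun ζ => N ζ ^ q']) (p := ![1 / q, 1 / q, 1 - 2 / q])
      (by
        intro i _
        fin_cases i
        · exact m1.aemeasurable
        · exact (m2.mul (hN.pow_const _)).aemeasurable
        · exact (hN.pow_const _).aemeasurable)
      (by simp [Fin.sum_univ_three]; ring)
      (by
        intro i _
        fin_cases i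
        · simp; positivity
        · simp; positivity
        · simp only [Fin.reduceFinMk, Matrix.cons_val, sub_nonneg]
          rw [div_le_one hq0]; exact hq.le)
    simp only [Fin.prod_univ_three, Matrix.cons_val_zero, Matrix.cons_val_one,
      Matrix.cons_val] at hol
    have hle : ∫⁻ ζ, k z ζ ∂ν ≤ (∫⁻ ζ, H₁ z ζ ∂ν) ^ (1 / q) *
        (∫⁻ ζ, H₂ z ζ * N ζ ^ q' ∂ν) ^ (1 / q) * S ^ (1 - 2 / q) := by
      refine (lintegral_mono fun ζ => ?_).trans hol
      refine (hk z ζ).trans (le_of_eq ?_)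
      have e : N ζ = (N ζ ^ q') ^ (1 / q) * (N ζ ^ q') ^ (1 - 2 / q) := by
        have h2q : 0 ≤ 1 - 2 / q := by rw [sub_nonneg, div_le_one hq0]; exact hq.le
        rw [← ENNReal.rpow_mul, ← ENNReal.rpow_mul,
          ← ENNReal.rpow_add_of_nonneg _ _ (by positivity) (by positivity)]
        rw [show q' * (1 / q) + q' * (1 - 2 / q) = 1 by rw [hqq]; field_simp; ring,
          ENNReal.rpow_one]
      rw [ENNReal.mul_rpow_of_nonneg _ _ (by positivity : 0 ≤ 1 / q)]
      conv_lhs => rw [e]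
      ring
    calc (∫⁻ ζ, k z ζ ∂ν) ^ q ≤ ((∫⁻ ζ, H₁ z ζ ∂ν) ^ (1 / q) *
        (∫⁻ ζ, H₂ z ζ * N ζ ^ q' ∂ν) ^ (1 / q) * S ^ (1 - 2 / q)) ^ q := by gcongr
      _ = (∫⁻ ζ, H₁ z ζ ∂ν) * (∫⁻ ζ, H₂ z ζ * N ζ ^ q' ∂ν) * S ^ (q - 2) := by
        rw [ENNReal.mul_rpow_of_nonneg _ _ hq0.le, ENNReal.mul_rpow_of_nonneg _ _ hq0.le,
          ← ENNReal.rpow_mul, ← ENNReal.rpow_mul, ← ENNReal.rpow_mul,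
          one_div_mul_cancel hq0.ne', ENNReal.rpow_one, ENNReal.rpow_one]
        congr 2
        field_simp
      _ ≤ _ := by gcongr; exact h₁ z
  have m2 : Measurable fun p : α × β => H₂ p.1 p.2 * N p.2 ^ q' :=
    hH₂.mul ((hN.comp measurable_snd).pow_const _)
  calc ∫⁻ z, (∫⁻ ζ, k z ζ ∂ν) ^ q ∂μ
      ≤ ∫⁻ z, B₁ * (∫⁻ ζ, H₂ z ζ * N ζ ^ q' ∂ν) * S ^ (q - 2) ∂μ := lintegral_mono pt
    _ = B₁ * (∫⁻ z, ∫⁻ ζ, H₂ z ζ * N ζ ^ q' ∂ν ∂μ) * S ^ (q - 2) := by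
      rw [lintegral_mul_const _ (m2.lintegral_prod_right'.const_mul _),
        lintegral_const_mul _ m2.lintegral_prod_right']
    _ = B₁ * (∫⁻ ζ, (∫⁻ z, H₂ z ζ ∂μ) * N ζ ^ q' ∂ν) * S ^ (q - 2) := by
      rw [lintegral_lintegral_swap m2.aemeasurable]
      congr 3 with ζ
      rw [lintegral_mul_const _ hH₂.of_uncurry_right]
    _ ≤ B₁ * (B₂ * S) * S ^ (q - 2) := by
      gcongr
      rw [hS, ← lintegral_const_mul _ (hN.pow_const _)]
      exact lintegral_mono fun ζ => by gcongr; exact h₂ ζ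
    _ = B₁ * B₂ * S ^ (q - 1) := by
      have : S ^ (q - 1) = S * S ^ (q - 2) := by
        conv_rhs => rw [← ENNReal.rpow_one S, ← ENNReal.rpow_mul, one_mul]
        rw [← ENNReal.rpow_add_of_nonneg _ _ zero_le_one (by linarith)]
        congr 1; ring
      rw [this]; ring

theorem setLIntegral_Ioc_rpow {d r : ℝ} (hd : 0 ≤ d) (hr : r < 1) :
    ∫⁻ y in Ioc 0 d, ENNReal.ofReal (y ^ (-r)) = ENNReal.ofReal (d ^ (1 - r) / (1 - r)) := by
  have hint : IntervalIntegrable (fun y : ℝ => y ^ (-r)) volume 0 d :=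
    intervalIntegral.intervalIntegrable_rpow' (by linarith)
  rw [intervalIntegrable_iff_integrableOn_Ioc_of_le hd] at hint
  rw [← ofReal_integral_eq_lintegral_ofReal hint, ← intervalIntegral.integral_of_le hd,
    integral_rpow (Or.inl (by linarith)), Real.zero_rpow (by linarith), sub_zero]
  · rw [show -r + 1 = 1 - r by ring]
  · filter_upwards [ae_restrict_mem measurableSet_Ioc] with y hy
    exact Real.rpow_nonneg hy.1.le _

/-- The integrand is dominated by a sum of two one-sided powers, one singular at each endpoint `±d`.
-/
theorem lintegral_sub_abs_rpow_le {d r : ℝ} (hd : 0 ≤ d) (hr : r < 1) :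
    ∫⁻ ξ : ℝ, (if |ξ| < d then ENNReal.ofReal ((d - |ξ|) ^ (-r)) else 0) ≤
      ENNReal.ofReal (2 * d ^ (1 - r) / (1 - r)) := by
  set f : ℝ → ENNReal := (Ioc 0 d).indicator fun y => ENNReal.ofReal (y ^ (-r)) with hf
  have hfm : Measurable f := Measurable.indicator (by fun_prop) measurableSet_Ioc
  have hfi : ∫⁻ y, f y = ENNReal.ofReal (d ^ (1 - r) / (1 - r)) := by
    rw [hf, lintegral_indicator measurableSet_Ioc, setLIntegral_Ioc_rpow hd hr]
  have hpos : 0 ≤ d ^ (1 - r) / (1 - r) :=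
    div_nonneg (Real.rpow_nonneg hd _) (by linarith)
  calc _ ≤ ∫⁻ ξ : ℝ, (f (d - ξ) + f (d + ξ)) := by
        refine lintegral_mono fun ξ => ?_
        simp only
        split_ifs with h
        · rcases le_total 0 ξ with h0 | h0
          · rw [abs_of_nonneg h0] at h ⊢
            refine le_add_right ?_
            rw [hf, indicator_of_mem (show d - ξ ∈ Ioc 0 d from ⟨by linarith, by linarith⟩)]
          · rw [abs_of_nonpos h0] at h ⊢
            refine le_add_left ?_
            rw [hf, indicator_of_mem (show d + ξ ∈ Ioc 0 d from ⟨by linarith, by linarith⟩),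
              sub_neg_eq_add]
        · exact zero_le
    _ = (∫⁻ y, f y) + ∫⁻ y, f y := by
        rw [lintegral_add_left (by fun_prop), lintegral_sub_left_eq_self f d,
          lintegral_add_left_eq_self f d]
    _ = _ := by
        rw [hfi, ← ENNReal.ofReal_add hpos hpos]
        congr 1; ring

open Classical in
/-- The kernel `(coneDist z ζ)^(-r)` on the backward cone. -/
noncomputable def coneKernel (r : ℝ) (z ζ : ℝ × ℝ) : ENNReal :=
  if 0 < z.1 ∧ ζ ∈ tricomiCone z then ENNReal.ofReal (coneDist z ζ ^ (-r)) else 0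

theorem measurable_coneKernel (r : ℝ) :
    Measurable fun p : (ℝ × ℝ) × (ℝ × ℝ) => coneKernel r p.1 p.2 := by
  classical
  have hφ := continuous_tricomiPhi.measurable
  have hD := continuous_coneDist.measurable
  refine Measurable.ite ?_ (by fun_prop) measurable_const
  exact (measurableSet_lt (f := fun _ : (ℝ × ℝ) × (ℝ × ℝ) => (0 : ℝ)) (g := fun p => p.1.1)
      (by fun_prop) (by fun_prop)).inter
    ((measurableSet_lt (f := fun _ : (ℝ × ℝ) × (ℝ × ℝ) => (0 : ℝ)) (g := fun p => p.2.1)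
      (by fun_prop) (by fun_prop)).inter
      (measurableSet_lt (f := fun p : (ℝ × ℝ) × (ℝ × ℝ) => |p.1.2 - p.2.2|)
        (g := fun p => tricomiPhi p.1.1 - tricomiPhi p.2.1) (by fun_prop) (by fun_prop)))

theorem coneKernel_of_le {r s t x y : ℝ} (h : t ≤ s) : coneKernel r (t, x) (s, y) = 0 := by
  rw [coneKernel, if_neg]
  rintro ⟨h1, h2, h3⟩
  simp only at h1 h2 h3
  have := tricomiPhi_le h1.le h
  linarith [abs_nonneg (x - y)]

theorem coneKernel_of_nonpos {r s t x y : ℝ} (h : s ≤ 0) : coneKernel r (t, x) (s, y) = 0 := by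
  rw [coneKernel, if_neg]
  rintro ⟨-, h2, -⟩
  exact absurd h2 (by simpa using h)

theorem coneKernel_eq {r s t x y : ℝ} (hs : 0 < s) (hst : s < t) :
    coneKernel r (t, x) (s, y) = ENNReal.ofReal (tricomiPhi t ^ (-r)) *
      (if |x - y| < tricomiPhi t - tricomiPhi s then
        ENNReal.ofReal ((tricomiPhi t - tricomiPhi s - |x - y|) ^ (-r)) else 0) := by
  have ht : 0 < t := hs.trans hst
  have h1 := tricomiPhi_pos ht
  by_cases h : |x - y| < tricomiPhi t - tricomiPhi s
  · rw [coneKernel, if_pos ⟨ht, hs, h⟩, if_pos h, coneDist,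
      Real.mul_rpow h1.le (by simp only; linarith), ENNReal.ofReal_mul (by positivity)]
  · rw [coneKernel, if_neg (fun hh => h hh.2.2), if_neg h, mul_zero]

theorem lintegral_coneKernel_aux {r s t : ℝ} (hr : r < 1) (hs : 0 < s) (hst : s < t) :
    ENNReal.ofReal (tricomiPhi t ^ (-r)) *
      ENNReal.ofReal (2 * (tricomiPhi t - tricomiPhi s) ^ (1 - r) / (1 - r)) ≤
      ENNReal.ofReal (2 / (1 - r) * tricomiPhi t ^ (1 - 2 * r)) := by
  have ht : 0 < t := hs.trans hst
  have h1 := tricomiPhi_pos ht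
  have h2 := tricomiPhi_pos hs
  have h3 := tricomiPhi_lt hs.le hst
  have h4 : 0 < 1 - r := by linarith
  rw [← ENNReal.ofReal_mul (by positivity)]
  refine ENNReal.ofReal_le_ofReal ?_
  calc tricomiPhi t ^ (-r) * (2 * (tricomiPhi t - tricomiPhi s) ^ (1 - r) / (1 - r))
      ≤ tricomiPhi t ^ (-r) * (2 * tricomiPhi t ^ (1 - r) / (1 - r)) := by
        have : 0 ≤ tricomiPhi t - tricomiPhi s := by linarith
        gcongr
        linarith
    _ = 2 / (1 - r) * (tricomiPhi t ^ (-r) * tricomiPhi t ^ (1 - r)) := by ring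
    _ = _ := by rw [← Real.rpow_add h1]; ring_nf

theorem lintegral_coneKernel_right {r s t x : ℝ} (hr : r < 1) (hs : 0 < s) (hst : s < t) :
    ∫⁻ y, coneKernel r (t, x) (s, y) ≤
      ENNReal.ofReal (2 / (1 - r) * tricomiPhi t ^ (1 - 2 * r)) := by
  simp only [coneKernel_eq hs hst]
  rw [lintegral_const_mul' _ _ (by finiteness)]
  refine le_trans ?_ (lintegral_coneKernel_aux hr hs hst)
  gcongr
  rw [lintegral_sub_left_eq_self (fun ξ : ℝ => if |ξ| < tricomiPhi t - tricomiPhi s then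
        ENNReal.ofReal ((tricomiPhi t - tricomiPhi s - |ξ|) ^ (-r)) else 0) x]
  exact lintegral_sub_abs_rpow_le (by linarith [tricomiPhi_lt hs.le hst]) hr

theorem lintegral_coneKernel_left {r s t y : ℝ} (hr : r < 1) (hs : 0 < s) (hst : s < t) :
    ∫⁻ x, coneKernel r (t, x) (s, y) ≤
      ENNReal.ofReal (2 / (1 - r) * tricomiPhi t ^ (1 - 2 * r)) := by
  simp only [coneKernel_eq hs hst]
  rw [lintegral_const_mul' _ _ (by finiteness)]
  refine le_trans ?_ (lintegral_coneKernel_aux hr hs hst)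
  gcongr
  rw [lintegral_sub_right_eq_self (fun ξ : ℝ => if |ξ| < tricomiPhi t - tricomiPhi s then
        ENNReal.ofReal ((tricomiPhi t - tricomiPhi s - |ξ|) ^ (-r)) else 0) y]
  exact lintegral_sub_abs_rpow_le (by linarith [tricomiPhi_lt hs.le hst]) hr

/-- The exponent `5/6` is critical: `φ(t)^(1 - 5/3)` is a constant times `1/t`, so the remaining
time integrals are scale invariant. -/
theorem tricomiPhi_rpow_le {t : ℝ} (ht : 0 < t) :
    2 / (1 - 5 / 6) * tricomiPhi t ^ (1 - 2 * (5 / 6) : ℝ) ≤ 24 / t := by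
  have h : tricomiPhi t ^ (1 - 2 * (5 / 6) : ℝ) = (3 / 2 : ℝ) ^ (2 / 3 : ℝ) * t⁻¹ := by
    rw [tricomiPhi, Real.mul_rpow (by norm_num) (by positivity), ← Real.rpow_mul ht.le,
      show (2 / 3 : ℝ) = (3 / 2)⁻¹ by norm_num, Real.inv_rpow (by norm_num),
      ← Real.rpow_neg (by norm_num), ← Real.rpow_neg_one t]
    norm_num
  have h2 : (3 / 2 : ℝ) ^ (2 / 3 : ℝ) ≤ 2 :=
    (Real.rpow_le_rpow_of_exponent_le (by norm_num) (by norm_num : (2 / 3 : ℝ) ≤ 1)).trans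
      (by norm_num)
  rw [h, div_eq_mul_inv 24]
  have : 0 < t⁻¹ := by positivity
  calc _ = 12 * (3 / 2 : ℝ) ^ (2 / 3 : ℝ) * t⁻¹ := by norm_num; ring
    _ ≤ 12 * 2 * t⁻¹ := by gcongr
    _ = _ := by norm_num

/-- After the space integral what remains is `(24/t) ∫₀ᵗ (s/t)^(-1/2) ds = 48`. The power of `s/t`
is inserted to match the dual bound `lintegral_coneKernel_mul_le_left`, where convergence at `t = ∞`
needs it. -/
theorem lintegral_coneKernel_mul_le_right (z : ℝ × ℝ) :
    ∫⁻ ζ : ℝ × ℝ, coneKernel (5 / 6) z ζ * ENNReal.ofReal ((ζ.1 / z.1) ^ (-(1 / 2) : ℝ)) ≤ 48 := by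
  obtain ⟨t, x⟩ := z
  have hm : Measurable fun ζ : ℝ × ℝ =>
      coneKernel (5 / 6) (t, x) ζ * ENNReal.ofReal ((ζ.1 / t) ^ (-(1 / 2) : ℝ)) := by
    have : Measurable fun ζ : ℝ × ℝ => coneKernel (5 / 6) (t, x) ζ :=
      (measurable_coneKernel _).of_uncurry_left
    fun_prop
  simp only
  rw [Measure.volume_eq_prod, lintegral_prod _ hm.aemeasurable]
  have inner : ∀ s : ℝ, ∫⁻ y : ℝ, coneKernel (5 / 6) (t, x) (s, y) *
      ENNReal.ofReal (((s, y).1 / t) ^ (-(1 / 2) : ℝ)) ≤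
      (Ioc 0 t).indicator (fun s => ENNReal.ofReal (24 * t ^ (-(1 / 2) : ℝ)) *
        ENNReal.ofReal (s ^ (-(1 / 2) : ℝ))) s := by
    intro s
    by_cases hs : s ≤ 0
    · simp [coneKernel_of_nonpos hs]
    by_cases hst : t ≤ s
    · simp [coneKernel_of_le hst]
    push Not at hs hst
    have ht : 0 < t := hs.trans hst
    rw [indicator_of_mem (show s ∈ Ioc 0 t from ⟨hs, hst.le⟩)]
    simp only
    rw [lintegral_mul_const' _ _ (by finiteness)]
    calc _ ≤ ENNReal.ofReal (24 / t) * ENNReal.ofReal ((s / t) ^ (-(1 / 2) : ℝ)) := by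
          gcongr
          exact (lintegral_coneKernel_right (by norm_num) hs hst).trans
            (ENNReal.ofReal_le_ofReal (tricomiPhi_rpow_le ht))
      _ = _ := by
          rw [← ENNReal.ofReal_mul (by positivity), ← ENNReal.ofReal_mul (by positivity)]
          congr 1
          have e : t * t ^ (-(1 / 2) : ℝ) = (t ^ (-(1 / 2) : ℝ))⁻¹ := by
            rw [← Real.rpow_neg ht.le, ← Real.rpow_one_add' ht.le (by norm_num)]
            norm_num
          rw [Real.div_rpow hs.le ht.le, div_eq_mul_inv (s ^ _), ← e]
          field_simp
  refine (lintegral_mono inner).trans ?_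
  rw [lintegral_indicator measurableSet_Ioc, lintegral_const_mul' _ _ (by finiteness)]
  rcases le_or_gt t 0 with ht | ht
  · simp [Ioc_eq_empty_of_le ht]
  rw [setLIntegral_Ioc_rpow ht.le (by norm_num), ← ENNReal.ofReal_mul (by positivity)]
  refine (ENNReal.ofReal_le_ofReal (le_of_eq ?_)).trans (by simp : ENNReal.ofReal 48 ≤ 48)
  have e : t ^ (-(1 / 2) : ℝ) * t ^ (1 - 1 / 2 : ℝ) = 1 := by
    rw [← Real.rpow_add ht]; norm_num
  linear_combination 48 * e

theorem lintegral_coneKernel_mul_le_left (ζ : ℝ × ℝ) :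
    ∫⁻ z : ℝ × ℝ, coneKernel (5 / 6) z ζ * ENNReal.ofReal ((ζ.1 / z.1) ^ (1 / 2 : ℝ)) ≤ 48 := by
  obtain ⟨s, y⟩ := ζ
  have hm : Measurable fun z : ℝ × ℝ =>
      coneKernel (5 / 6) z (s, y) * ENNReal.ofReal ((s / z.1) ^ (1 / 2 : ℝ)) := by
    have : Measurable fun z : ℝ × ℝ => coneKernel (5 / 6) z (s, y) :=
      (measurable_coneKernel _).of_uncurry_right
    fun_prop
  simp only
  rw [Measure.volume_eq_prod, lintegral_prod _ hm.aemeasurable]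
  rcases le_or_gt s 0 with hs | hs
  · simp [coneKernel_of_nonpos hs]
  have inner : ∀ t : ℝ, ∫⁻ x : ℝ, coneKernel (5 / 6) (t, x) (s, y) *
      ENNReal.ofReal ((s / (t, x).1) ^ (1 / 2 : ℝ)) ≤
      (Ioi s).indicator (fun t => ENNReal.ofReal (24 * s ^ (1 / 2 : ℝ)) *
        ENNReal.ofReal (t ^ (-(3 / 2) : ℝ))) t := by
    intro t
    by_cases hst : t ≤ s
    · simp [coneKernel_of_le hst]
    push Not at hst
    have ht : 0 < t := hs.trans hst
    rw [indicator_of_mem (by exact hst)]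
    simp only
    rw [lintegral_mul_const' _ _ (by finiteness)]
    calc _ ≤ ENNReal.ofReal (24 / t) * ENNReal.ofReal ((s / t) ^ (1 / 2 : ℝ)) := by
          gcongr
          exact (lintegral_coneKernel_left (by norm_num) hs hst).trans
            (ENNReal.ofReal_le_ofReal (tricomiPhi_rpow_le ht))
      _ = _ := by
          rw [← ENNReal.ofReal_mul (by positivity), ← ENNReal.ofReal_mul (by positivity)]
          congr 1
          have e : t ^ (-(3 / 2) : ℝ) = t⁻¹ * (t ^ (1 / 2 : ℝ))⁻¹ := by
            rw [← Real.rpow_neg ht.le, ← Real.rpow_neg_one, ← Real.rpow_add ht]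
            norm_num
          rw [Real.div_rpow hs.le ht.le, e]
          field_simp
  refine (lintegral_mono inner).trans ?_
  rw [lintegral_indicator measurableSet_Ioi, lintegral_const_mul' _ _ (by finiteness),
    ← ofReal_integral_eq_lintegral_ofReal (integrableOn_Ioi_rpow_of_lt (by norm_num) hs),
    integral_Ioi_rpow_of_lt (by norm_num) hs, ← ENNReal.ofReal_mul (by positivity)]
  · refine (ENNReal.ofReal_le_ofReal (le_of_eq ?_)).trans (by simp : ENNReal.ofReal 48 ≤ 48)
    have e : s ^ (1 / 2 : ℝ) * s ^ (-(3 / 2) + 1 : ℝ) = 1 := by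
      rw [← Real.rpow_add hs]; norm_num
    linear_combination 48 * e
  · filter_upwards [ae_restrict_mem measurableSet_Ioi] with t ht
    exact Real.rpow_nonneg (hs.trans ht).le _

/-- Factor the right side as `(φ(t)+M+|x|)(φ(t)+M-|x|)`. The first factor exceeds `φ(t)`; the second
is at least `φ(t) - φ(s) - |x-y|` by the triangle inequality. Hence the product form of `coneDist`.
-/
theorem coneDist_le {z ζ : ℝ × ℝ} {M : ℝ} (hM : 0 < M) (hz : 0 < z.1) (hζ : ζ ∈ tricomiCone z)
    (h : |ζ.2| ≤ tricomiPhi ζ.1 + M) :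
    coneDist z ζ ≤ (tricomiPhi z.1 + M) ^ 2 - z.2 ^ 2 := by
  have h1 := tricomiPhi_pos hz
  have h2 := abs_le.1 h
  have h3 := hζ.2
  have h4 : |z.2| ≤ |z.2 - ζ.2| + |ζ.2| := by simpa using abs_add_le (z.2 - ζ.2) ζ.2
  have e : (tricomiPhi z.1 + M) ^ 2 - z.2 ^ 2 =
      (tricomiPhi z.1 + M + |z.2|) * (tricomiPhi z.1 + M - |z.2|) := by
    linear_combination sq_abs z.2
  rw [e, coneDist]
  have := abs_nonneg z.2
  exact mul_le_mul (by linarith) (by linarith) (by linarith) (by linarith)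

/-- The weighted bound for the integral operator with kernel `(coneDist z ζ)^(-1/6)`. -/
theorem lintegral_weight_mul_cone_rpow_le {q q' κ M : ℝ} (hq : 6 < q) (hq10 : q < 10)
    (hqq : q' = q / (q - 1)) (hκ : κ = 5 / (3 * q) - 1 / 6) (hM : 0 < M) {N : ℝ × ℝ → ENNReal}
    (hN : Measurable N)
    (hsupp : ∀ ζ : ℝ × ℝ, 0 < ζ.1 → tricomiPhi ζ.1 + M < |ζ.2| → N ζ = 0) :
    ∫⁻ z in Ioi (0 : ℝ) ×ˢ univ, (‖((tricomiPhi z.1 + M) ^ 2 - z.2 ^ 2) ^ (-κ)‖ₑ *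
      ∫⁻ ζ in tricomiCone z, ENNReal.ofReal (coneDist z ζ ^ (-(1 / 6) : ℝ)) * N ζ) ^ q ≤
      48 * 48 * (∫⁻ ζ, N ζ ^ q') ^ (q - 1) := by
  have hκ0 : 0 < κ := by
    rw [hκ, sub_pos, div_lt_div_iff₀ (by norm_num) (by linarith)]; linarith
  have hq0 : 0 < q := by linarith
  set H₁ : ℝ × ℝ → ℝ × ℝ → ENNReal := fun z ζ =>
    coneKernel (5 / 6) z ζ * ENNReal.ofReal ((ζ.1 / z.1) ^ (-(1 / 2) : ℝ)) with hH₁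
  set H₂ : ℝ × ℝ → ℝ × ℝ → ENNReal := fun z ζ =>
    coneKernel (5 / 6) z ζ * ENNReal.ofReal ((ζ.1 / z.1) ^ (1 / 2 : ℝ)) with hH₂
  have mk := measurable_coneKernel (5 / 6)
  have key := lintegral_kernel_rpow_le (μ := volume) (ν := volume) (by linarith) hqq (N := N)
    (k := fun z ζ => H₁ z ζ ^ (1 / q) * H₂ z ζ ^ (1 / q) * N ζ) (H₁ := H₁) (H₂ := H₂)
    (by simp only [hH₁, Function.uncurry_def]; fun_prop)
    (by simp only [hH₂, Function.uncurry_def]; fun_prop) hN (fun _ _ => le_rfl)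
    lintegral_coneKernel_mul_le_right lintegral_coneKernel_mul_le_left
  refine le_trans ?_ key
  refine (setLIntegral_mono' (measurableSet_Ioi.prod MeasurableSet.univ) fun z hz => ?_).trans
    (setLIntegral_le_lintegral (Ioi (0 : ℝ) ×ˢ univ) _)
  have hz0 : 0 < z.1 := hz.1
  refine ENNReal.rpow_le_rpow ?_ hq0.le
  rw [← lintegral_const_mul' _ _ (by finiteness)]
  refine (setLIntegral_mono' (isOpen_tricomiCone z).measurableSet fun ζ hζ => ?_).trans
    (setLIntegral_le_lintegral (tricomiCone z) _)
  -- Where the integrand is nonzero, `coneDist_le` makes the base of the weight positive, so the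
  -- value of the real power at a negative base never enters.
  by_cases hNζ : N ζ = 0
  · simp [hNζ]
  have hin : |ζ.2| ≤ tricomiPhi ζ.1 + M := by
    by_contra! hc
    exact hNζ (hsupp ζ hζ.1 hc)
  have hD : 0 < coneDist z ζ := mul_pos (tricomiPhi_pos hz0) (by linarith [hζ.2])
  have hDρ := coneDist_le hM hz0 hζ hin
  rw [← mul_assoc]
  refine mul_le_mul' ?_ le_rfl
  have hr : 0 < ζ.1 / z.1 := div_pos hζ.1 hz0
  have e1 : H₁ z ζ * H₂ z ζ = ENNReal.ofReal (coneDist z ζ ^ (-(5 / 6) : ℝ)) ^ (2 : ℝ) := by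
    simp only [hH₁, hH₂, coneKernel]
    rw [if_pos ⟨hz0, hζ⟩, ← ENNReal.ofReal_mul (by positivity), ← ENNReal.ofReal_mul (by positivity),
      ← ENNReal.ofReal_mul (by positivity), ENNReal.ofReal_rpow_of_pos (by positivity)]
    congr 1
    have : (ζ.1 / z.1) ^ (-(1 / 2) : ℝ) * (ζ.1 / z.1) ^ (1 / 2 : ℝ) = 1 := by
      rw [← Real.rpow_add hr]; norm_num
    rw [Real.rpow_two]
    linear_combination (coneDist z ζ ^ (-(5 / 6) : ℝ)) ^ 2 * this
  rw [← ENNReal.mul_rpow_of_nonneg _ _ (by positivity : 0 ≤ 1 / q), e1, ← ENNReal.rpow_mul,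
    ENNReal.ofReal_rpow_of_pos (by positivity), ← Real.rpow_mul hD.le,
    Real.enorm_of_nonneg (Real.rpow_nonneg (hD.le.trans hDρ) _),
    ← ENNReal.ofReal_mul (Real.rpow_nonneg (hD.le.trans hDρ) _)]
  refine ENNReal.ofReal_le_ofReal ?_
  -- The positivity of `κ` is used here; then `-κ - 1/6 = -5/(3q) = -(5/6)(2/q)`.
  calc _ ≤ coneDist z ζ ^ (-κ) * coneDist z ζ ^ (-(1 / 6) : ℝ) := by
        refine mul_le_mul_of_nonneg_right ?_ (by positivity)
        exact Real.rpow_le_rpow_of_nonpos hD hDρ (by linarith)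
    _ = _ := by
        rw [← Real.rpow_add hD, hκ]
        congr 1
        field_simp
        ring

/-! ### Regularization of distributional solutions -/

/-- Smooth functions with compact support on the line. -/
structure IsTest (a : ℝ → ℝ) : Prop where
  contDiff : ContDiff ℝ ∞ a
  hasCompactSupport : HasCompactSupport a

theorem IsTest.deriv {a : ℝ → ℝ} (h : IsTest a) : IsTest (deriv a) :=
  ⟨h.contDiff.deriv' , h.hasCompactSupport.deriv⟩

theorem IsTest.hasDerivAt {a : ℝ → ℝ} (h : IsTest a) (t : ℝ) : HasDerivAt a (_root_.deriv a t) t :=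
  (h.contDiff.differentiable (by simp) t).hasDerivAt

theorem IsTest.continuous {a : ℝ → ℝ} (h : IsTest a) : Continuous a := h.contDiff.continuous

theorem IsTest.id_mul {a : ℝ → ℝ} (h : IsTest a) : IsTest fun t => t * a t :=
  ⟨contDiff_id.mul h.contDiff, h.hasCompactSupport.mul_left⟩

/-- The function `(t, x) ↦ a t * b x`. -/
def tensorFn (a b : ℝ → ℝ) (z : ℝ × ℝ) : ℝ := a z.1 * b z.2

theorem IsTest.contDiff_tensorFn {a b : ℝ → ℝ} (ha : IsTest a) (hb : IsTest b) :
    ContDiff ℝ ∞ (tensorFn a b) :=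
  (ha.contDiff.comp contDiff_fst).mul (hb.contDiff.comp contDiff_snd)

theorem IsTest.hasCompactSupport_tensorFn {a b : ℝ → ℝ} (ha : IsTest a) (hb : IsTest b) :
    HasCompactSupport (tensorFn a b) := by
  refine HasCompactSupport.intro
    (IsCompact.prod ha.hasCompactSupport hb.hasCompactSupport) fun z hz => ?_
  rw [mem_prod, not_and_or] at hz
  rw [tensorFn]
  rcases hz with h | h
  · rw [image_eq_zero_of_notMem_tsupport h, zero_mul]
  · rw [image_eq_zero_of_notMem_tsupport h, mul_zero]

/-- The convolution of `f` with the kernel `k`. -/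
noncomputable def mollify (f k : ℝ × ℝ → ℝ) (z : ℝ × ℝ) : ℝ := ∫ ζ, f ζ * k (z - ζ)

theorem integrable_mollify {f k : ℝ × ℝ → ℝ} (hf : LocallyIntegrable f volume)
    (hk : Continuous k) (hks : HasCompactSupport k) (z : ℝ × ℝ) :
    Integrable fun ζ => f ζ * k (z - ζ) :=
  hks.convolutionExists_right (ContinuousLinearMap.mul ℝ ℝ) hf hk z

theorem hasPartials_mollify_tensorFn {f : ℝ × ℝ → ℝ} (hf : LocallyIntegrable f volume)
    {a b : ℝ → ℝ} (ha : IsTest a) (hb : IsTest b) :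
    HasPartials (mollify f (tensorFn a b)) (mollify f (tensorFn (deriv a) b))
      (mollify f (tensorFn a (deriv b))) := by
  intro z
  have hc := ha.hasCompactSupport_tensorFn hb
  have hd : ContDiff ℝ 1 (tensorFn a b) := (ha.contDiff_tensorFn hb).of_le (by simp)
  have h := hc.hasFDerivAt_convolution_right (ContinuousLinearMap.mul ℝ ℝ) hf hd z
  have hfd : ∀ y : ℝ × ℝ, HasFDerivAt (tensorFn a b)
      (a y.1 • (deriv b y.2 • ContinuousLinearMap.snd ℝ ℝ ℝ)
        + b y.2 • (deriv a y.1 • ContinuousLinearMap.fst ℝ ℝ ℝ)) y := fun y =>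
    ((ha.hasDerivAt y.1).comp_hasFDerivAt y hasFDerivAt_fst).mul
      ((hb.hasDerivAt y.2).comp_hasFDerivAt y hasFDerivAt_snd)
  refine h.congr_fderiv ?_
  have happ := fun v : ℝ × ℝ => convolution_precompR_apply (μ := volume)
    (ContinuousLinearMap.mul ℝ ℝ) hf (hc.fderiv ℝ) (hd.continuous_fderiv one_ne_zero) z v
  ext
  · simp only [ContinuousLinearMap.coe_comp, Function.comp_apply, ContinuousLinearMap.inl_apply]
    rw [happ]
    simp only [convolution_def, (hfd _).fderiv, mollify, tensorFn]
    simp [mul_comm]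
  · simp only [ContinuousLinearMap.coe_comp, Function.comp_apply, ContinuousLinearMap.inr_apply]
    rw [happ]
    simp only [convolution_def, (hfd _).fderiv, mollify, tensorFn]
    simp [mul_comm]

/-- Because the mollifier looks only into the past by at least `δ`, the regularized function
vanishes for small times, as the representation formula requires. -/
theorem mollify_eq_zero {f : ℝ × ℝ → ℝ} (hf : ∀ z : ℝ × ℝ, z.1 ≤ 0 → f z = 0) {a b : ℝ → ℝ} {δ : ℝ}
    (ha : ∀ t < δ, a t = 0) {z : ℝ × ℝ} (hz : z.1 < δ) : mollify f (tensorFn a b) z = 0 := by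
  rw [mollify, integral_eq_zero_of_ae]
  refine Filter.Eventually.of_forall fun ζ => ?_
  rcases le_or_gt ζ.1 0 with h | h
  · simp [hf ζ h]
  · have : (z - ζ).1 < δ := by simp only [Prod.fst_sub]; linarith
    change f ζ * (a (z - ζ).1 * b (z - ζ).2) = 0
    rw [ha _ this, zero_mul, mul_zero]

theorem deriv_eq_zero_of_lt {a : ℝ → ℝ} {δ : ℝ} (ha : ∀ t < δ, a t = 0) :
    ∀ t < δ, deriv a t = 0 := fun t ht => by
  have : a =ᶠ[nhds t] fun _ => 0 := by
    filter_upwards [gt_mem_nhds ht] with s hs using ha s hs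
  rw [this.deriv_eq, deriv_const]

theorem iteratedDeriv_two_comp_const_sub_mul {a : ℝ → ℝ} (ha : IsTest a) (c k s : ℝ) :
    iteratedDeriv 2 (fun s => a (c - s) * k) s = deriv (deriv a) (c - s) * k := by
  have aux : ∀ {a : ℝ → ℝ}, IsTest a → ∀ k s : ℝ,
      HasDerivAt (fun s => a (c - s) * k) (deriv a (c - s) * -k) s := by
    intro a ha k s
    have h1 : HasDerivAt (fun s : ℝ => c - s) (-1) s := by
      simpa using (hasDerivAt_id s).const_sub c
    refine (((ha.hasDerivAt (c - s)).comp s h1).mul_const k).congr_deriv ?_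
    ring
  rw [iteratedDeriv_succ, iteratedDeriv_one]
  have : deriv (fun s => a (c - s) * k) = fun s => deriv a (c - s) * -k :=
    funext fun s => (aux ha k s).deriv
  rw [this, (aux ha.deriv (-k) s).deriv, neg_neg]

theorem tricomiOp_tensorFn {a b : ℝ → ℝ} (ha : IsTest a) (hb : IsTest b) (z ζ : ℝ × ℝ) :
    tricomiOp (fun ζ => tensorFn a b (z - ζ)) ζ =
      tensorFn (deriv (deriv a)) b (z - ζ) - ζ.1 * tensorFn a (deriv (deriv b)) (z - ζ) := by
  have h := iteratedDeriv_two_comp_const_sub_mul hb z.2 (a (z.1 - ζ.1)) ζ.2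
  simp only [mul_comm _ (a (z.1 - ζ.1))] at h
  simp only [tricomiOp, tensorFn, Prod.fst_sub, Prod.snd_sub]
  rw [iteratedDeriv_two_comp_const_sub_mul ha, h]

/-- The equation satisfied by the regularization of a distributional solution. -/
theorem mollify_equation {f F : ℝ × ℝ → ℝ} (hf : LocallyIntegrable f volume)
    (hw : ∀ ψ : ℝ × ℝ → ℝ, ContDiff ℝ ∞ ψ → HasCompactSupport ψ →
      ∫ z, f z * tricomiOp ψ z = ∫ z, F z * ψ z)
    {a b : ℝ → ℝ} (ha : IsTest a) (hb : IsTest b) (z : ℝ × ℝ) :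
    mollify f (tensorFn (deriv (deriv a)) b) z
      - z.1 * mollify f (tensorFn a (deriv (deriv b))) z =
    mollify F (tensorFn a b) z - mollify f (tensorFn (fun t => t * a t) (deriv (deriv b))) z := by
  -- Testing with the reflected mollifier puts the coefficient at the time of `ζ`; moving it to the
  -- time of `z` costs `z.1 - ζ.1`, the time argument of `a`, hence the kernel `t * a t`.
  have h1 := hw (fun ζ => tensorFn a b (z - ζ))
    ((ha.contDiff_tensorFn hb).comp (contDiff_const.sub contDiff_id))
    ((ha.hasCompactSupport_tensorFn hb).comp_homeomorph (Homeomorph.subLeft z))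
  simp only [tricomiOp_tensorFn ha hb] at h1
  have int := fun {a b : ℝ → ℝ} (ha : IsTest a) (hb : IsTest b) =>
    integrable_mollify hf (ha.contDiff_tensorFn hb).continuous (ha.hasCompactSupport_tensorFn hb) z
  have i1 := int ha.deriv.deriv hb
  have i2 := int ha hb.deriv.deriv
  have i3 := int ha.id_mul hb.deriv.deriv
  rw [mollify, mollify, mollify, mollify, ← h1, ← integral_const_mul,
    ← integral_sub i1 (i2.const_mul _), ← integral_sub _ i3]
  · refine integral_congr_ae (Filter.Eventually.of_forall fun ζ => ?_)
    simp only [tensorFn, Prod.fst_sub, Prod.snd_sub]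
    ring
  · refine ((i1.sub (i2.const_mul z.1)).add i3).congr (Filter.Eventually.of_forall fun ζ => ?_)
    simp only [tensorFn, Prod.fst_sub, Prod.snd_sub, Pi.add_apply, Pi.sub_apply]
    ring

theorem enorm_mollify_le (f k : ℝ × ℝ → ℝ) (z : ℝ × ℝ) :
    ‖mollify f k z‖ₑ ≤ ∫⁻ ζ, ‖f ζ‖ₑ * ‖k (z - ζ)‖ₑ := by
  refine (enorm_integral_le_lintegral_enorm _).trans (le_of_eq ?_)
  simp only [enorm_mul]

theorem exists_isTest_bump (c : ℝ) {r : ℝ} (hr : 0 < r) : ∃ a : ℝ → ℝ, IsTest a ∧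
    (∀ t, 0 ≤ a t) ∧ ∫⁻ t, ‖a t‖ₑ = 1 ∧ ∀ t, a t ≠ 0 → |t - c| < r := by
  let φ : ContDiffBump c := ⟨r / 2, r, by positivity, by linarith⟩
  refine ⟨φ.normed volume, ⟨φ.contDiff_normed (n := ⊤), φ.hasCompactSupport_normed⟩,
    φ.nonneg_normed, ?_, fun t ht => ?_⟩
  · have h := φ.integral_normed (μ := volume)
    have h2 := ofReal_integral_eq_lintegral_ofReal (φ.integrable_normed (μ := volume))
      (Filter.Eventually.of_forall φ.nonneg_normed)
    rw [h, ENNReal.ofReal_one] at h2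
    rw [h2]
    exact lintegral_congr fun t => Real.enorm_of_nonneg (φ.nonneg_normed t)
  · have : t ∈ Function.support (φ.normed volume) := ht
    rw [φ.support_normed_eq] at this
    exact this

theorem lintegral_enorm_tensorFn {a b : ℝ → ℝ} (ha : Continuous a) (hb : Continuous b) :
    ∫⁻ z, ‖tensorFn a b z‖ₑ = (∫⁻ t, ‖a t‖ₑ) * ∫⁻ x, ‖b x‖ₑ := by
  simp only [tensorFn, enorm_mul]
  rw [Measure.volume_eq_prod,
    lintegral_prod_mul (f := fun t => ‖a t‖ₑ) (g := fun x => ‖b x‖ₑ)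
      (by fun_prop) (by fun_prop)]

theorem exists_mollifier {r : ℝ} (hr : 0 < r) : ∃ (a b : ℝ → ℝ) (δ : ℝ), 0 < δ ∧
    IsTest a ∧ IsTest b ∧ (∀ t < δ, a t = 0) ∧ (∀ z, 0 ≤ tensorFn a b z) ∧
    ∫⁻ z, ‖tensorFn a b z‖ₑ = 1 ∧
    ∫⁻ z, ‖tensorFn (fun t => t * a t) (deriv (deriv b)) z‖ₑ ≤ ENNReal.ofReal r ∧
    (∀ z, tensorFn a b z ≠ 0 → ‖z‖ < r) ∧
    (∀ z, tensorFn (fun t => t * a t) (deriv (deriv b)) z ≠ 0 → ‖z‖ < r) := by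
  obtain ⟨b, hb, hb0, hb1, hbs⟩ := exists_isTest_bump 0 (half_pos hr)
  have hfin : ∫⁻ x, ‖deriv (deriv b) x‖ₑ < ⊤ :=
    (hb.deriv.deriv.continuous.integrable_of_hasCompactSupport
      hb.deriv.deriv.hasCompactSupport).hasFiniteIntegral
  set K := (∫⁻ x, ‖deriv (deriv b) x‖ₑ).toReal with hK
  have hK0 : 0 ≤ K := ENNReal.toReal_nonneg
  -- The time scale is fixed after the space profile `b`: since `a` lives in `(δ, 3δ)`, the
  -- commutator kernel has `L¹` norm at most `3 δ K ≤ r`.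
  set δ := r / (3 * (1 + K)) with hδ
  have hδ0 : 0 < δ := by positivity
  have h3δ : 3 * δ * (1 + K) = r := by rw [hδ]; field_simp
  have h3δr : 3 * δ ≤ r := by nlinarith
  obtain ⟨a, ha, ha0, ha1, has⟩ := exists_isTest_bump (2 * δ) hδ0
  have hat : ∀ t, a t ≠ 0 → δ < t ∧ t < 3 * δ := fun t ht => by
    have := abs_lt.1 (has t ht)
    constructor <;> linarith
  have hbsupp : ∀ x, deriv (deriv b) x ≠ 0 → |x| < r := fun x hx => by
    have h1 : Function.support b ⊆ Metric.closedBall 0 (r / 2) := fun y hy => by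
      have := (hbs y hy).le
      simpa using this
    have h2 : tsupport b ⊆ Metric.closedBall 0 (r / 2) :=
      closure_minimal h1 Metric.isClosed_closedBall
    have h3 := h2 (tsupport_deriv_subset (support_deriv_subset hx))
    have : |x| ≤ r / 2 := by simpa using h3
    linarith
  refine ⟨a, b, δ, hδ0, ha, hb, fun t ht => ?_, fun z => mul_nonneg (ha0 _) (hb0 _), ?_, ?_, ?_, ?_⟩
  · by_contra h
    exact absurd (hat t h).1 ht.not_gt
  · rw [lintegral_enorm_tensorFn ha.continuous hb.continuous, ha1, hb1, one_mul]
  · rw [lintegral_enorm_tensorFn ha.id_mul.continuous hb.deriv.deriv.continuous]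
    calc (∫⁻ t, ‖t * a t‖ₑ) * ∫⁻ x, ‖deriv (deriv b) x‖ₑ
        ≤ ENNReal.ofReal (3 * δ) * ENNReal.ofReal K := by
          rw [hK, ENNReal.ofReal_toReal hfin.ne]
          gcongr
          rw [← mul_one (ENNReal.ofReal _), ← ha1, ← lintegral_const_mul' _ _ (by finiteness)]
          refine lintegral_mono fun t => ?_
          by_cases h : a t = 0
          · simp [h]
          · rw [enorm_mul]
            have := hat t h
            gcongr
            rw [Real.enorm_of_nonneg (by linarith)]
            exact ENNReal.ofReal_le_ofReal this.2.le
      _ = ENNReal.ofReal (3 * δ * K) := (ENNReal.ofReal_mul (by positivity)).symm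
      _ ≤ ENNReal.ofReal r := ENNReal.ofReal_le_ofReal (by nlinarith)
  · intro z hz
    rw [tensorFn, mul_ne_zero_iff] at hz
    have h1 := hat _ hz.1
    have h2 := hbs _ hz.2
    rw [Prod.norm_def, max_lt_iff, Real.norm_eq_abs, Real.norm_eq_abs, abs_of_pos (by linarith)]
    rw [sub_zero] at h2
    exact ⟨by linarith, by linarith⟩
  · intro z hz
    rw [tensorFn, mul_ne_zero_iff, mul_ne_zero_iff] at hz
    have h1 := hat _ hz.1.2
    have h2 := hbsupp _ hz.2
    rw [Prod.norm_def, max_lt_iff, Real.norm_eq_abs, Real.norm_eq_abs, abs_of_pos (by linarith)]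
    exact ⟨by linarith, h2⟩

theorem setLIntegral_tricomiCone {r : ℝ} {z : ℝ × ℝ} (hz : 0 < z.1) (g : ℝ × ℝ → ENNReal) :
    ∫⁻ ζ in tricomiCone z, ENNReal.ofReal (coneDist z ζ ^ (-r)) * g ζ =
      ∫⁻ ζ, coneKernel r z ζ * g ζ := by
  rw [← lintegral_indicator (isOpen_tricomiCone z).measurableSet]
  refine lintegral_congr fun ζ => ?_
  by_cases h : ζ ∈ tricomiCone z
  · rw [indicator_of_mem h, coneKernel, if_pos ⟨hz, h⟩]
  · rw [indicator_of_notMem h, coneKernel, if_neg (fun hh => h hh.2), zero_mul]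

/-- Convolution of nonnegative functions. -/
noncomputable def lmollify (f k : ℝ × ℝ → ENNReal) (z : ℝ × ℝ) : ENNReal := ∫⁻ ζ, f ζ * k (z - ζ)

/-- A distributional solution is bounded by the cone kernel applied to a mollification of the
source, up to errors that are small in `L¹_loc`. -/
theorem exists_enorm_le_regularized : ∃ A : ℝ, 0 < A ∧ ∀ f F : ℝ × ℝ → ℝ,
    LocallyIntegrable f volume → (∀ z : ℝ × ℝ, z.1 ≤ 0 → f z = 0) →
    (∀ z : ℝ × ℝ, z.1 ≤ 0 → F z = 0) →
    (∀ ψ : ℝ × ℝ → ℝ, ContDiff ℝ ∞ ψ → HasCompactSupport ψ →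
      ∫ z, f z * tricomiOp ψ z = ∫ z, F z * ψ z) →
    ∀ r : ℝ, 0 < r → ∃ k c : ℝ × ℝ → ENNReal, Measurable k ∧ Measurable c ∧
      ∫⁻ z, k z = 1 ∧ ∫⁻ z, c z ≤ ENNReal.ofReal r ∧
      (∀ z, k z ≠ 0 → 0 < z.1 ∧ ‖z‖ < r) ∧ (∀ z, c z ≠ 0 → ‖z‖ < r) ∧
      ∀ z : ℝ × ℝ, 0 < z.1 → ‖f z‖ₑ ≤ (∫⁻ ζ, ‖f ζ - f z‖ₑ * k (z - ζ)) +
        ENNReal.ofReal A * ∫⁻ ζ, coneKernel (1 / 6) z ζ *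
          (lmollify (fun ζ => ‖F ζ‖ₑ) k ζ + lmollify (fun ζ => ‖f ζ‖ₑ) c ζ) := by
  obtain ⟨A, hA, hbound⟩ := exists_enorm_le_lintegral_cone
  refine ⟨A, hA, fun f F hf hf0 hF0 hw r hr => ?_⟩
  obtain ⟨a, b, δ, hδ, ha, hb, haδ, hpos, hint1, hintr, hsk, hsc⟩ := exists_mollifier hr
  set c : ℝ × ℝ → ℝ := tensorFn (fun t => t * a t) (deriv (deriv b)) with hc
  have hη := ha.contDiff_tensorFn hb
  have hcc : Continuous c := (ha.id_mul.contDiff_tensorFn hb.deriv.deriv).continuous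
  refine ⟨fun z => ‖tensorFn a b z‖ₑ, fun z => ‖c z‖ₑ, by have := hη.continuous; fun_prop,
    by fun_prop, hint1, hintr, fun z hz => ?_, fun z hz => hsc z (by simpa using hz), ?_⟩
  · have hz' : tensorFn a b z ≠ 0 := by simpa using hz
    refine ⟨?_, hsk z hz'⟩
    rw [tensorFn, mul_ne_zero_iff] at hz'
    by_contra! h
    exact hz'.1 (haδ _ (by linarith))
  intro z hz
  have haδ' := deriv_eq_zero_of_lt haδ
  have haδ'' := deriv_eq_zero_of_lt haδ'
  have main := hbound (mollify f (tensorFn a b)) _ _ _ _ _ δ hδ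
    (hasPartials_mollify_tensorFn hf ha hb) (hasPartials_mollify_tensorFn hf ha.deriv hb)
    (hasPartials_mollify_tensorFn hf ha hb.deriv)
    (hasPartials_mollify_tensorFn hf ha.deriv.deriv hb).continuous
    (hasPartials_mollify_tensorFn hf ha hb.deriv.deriv).continuous
    (fun z hz => mollify_eq_zero hf0 haδ hz) (fun z hz => mollify_eq_zero hf0 haδ' hz)
    (fun z hz => mollify_eq_zero hf0 haδ hz) (fun z hz => mollify_eq_zero hf0 haδ'' hz)
    (fun z hz => mollify_eq_zero hf0 haδ hz) z hz
  rw [setLIntegral_tricomiCone hz] at main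
  have hdiff : ‖mollify f (tensorFn a b) z - f z‖ₑ ≤
      ∫⁻ ζ, ‖f ζ - f z‖ₑ * ‖tensorFn a b (z - ζ)‖ₑ := by
    have i1 := integrable_mollify hf hη.continuous (ha.hasCompactSupport_tensorFn hb) z
    have i2 : Integrable fun ζ => tensorFn a b (z - ζ) :=
      (hη.continuous.integrable_of_hasCompactSupport
        (ha.hasCompactSupport_tensorFn hb)).comp_sub_left z
    have h1 : ∫ ζ, tensorFn a b (z - ζ) = 1 := by
      rw [integral_sub_left_eq_self, integral_eq_lintegral_of_nonneg_ae
        (Filter.Eventually.of_forall hpos) hη.continuous.aestronglyMeasurable]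
      have : ∫⁻ z, ENNReal.ofReal (tensorFn a b z) = 1 := by
        rw [← hint1]
        exact lintegral_congr fun z => (Real.enorm_of_nonneg (hpos z)).symm
      rw [this, ENNReal.toReal_one]
    have h2 : f z = ∫ ζ, f z * tensorFn a b (z - ζ) := by rw [integral_const_mul, h1, mul_one]
    conv_lhs => rw [h2]
    rw [mollify, ← integral_sub i1 (i2.const_mul _)]
    refine (enorm_integral_le_lintegral_enorm _).trans (le_of_eq ?_)
    refine lintegral_congr fun ζ => ?_
    rw [← sub_mul, enorm_mul]
  calc ‖f z‖ₑ = ‖f z - mollify f (tensorFn a b) z + mollify f (tensorFn a b) z‖ₑ := by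
        rw [sub_add_cancel]
    _ ≤ ‖f z - mollify f (tensorFn a b) z‖ₑ + ‖mollify f (tensorFn a b) z‖ₑ := enorm_add_le _ _
    _ ≤ _ := by
        rw [enorm_sub_rev]
        refine add_le_add hdiff (main.trans ?_)
        gcongr with ζ
        rw [mollify_equation hf hw ha hb]
        refine enorm_sub_le.trans (add_le_add (enorm_mollify_le _ _ _) (enorm_mollify_le _ _ _))

/-! ### Passage to the limit -/

theorem measurable_lmollify {f k : ℝ × ℝ → ENNReal} (hf : Measurable f) (hk : Measurable k) :
    Measurable (lmollify f k) := by
  have : Measurable fun p : (ℝ × ℝ) × (ℝ × ℝ) => f p.2 * k (p.1 - p.2) := by fun_prop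
  exact this.lintegral_prod_right'

theorem lintegral_lmollify {f k : ℝ × ℝ → ENNReal} (hf : Measurable f) (hk : Measurable k) :
    ∫⁻ z, lmollify f k z = (∫⁻ z, k z) * ∫⁻ z, f z := by
  have : Measurable fun p : (ℝ × ℝ) × (ℝ × ℝ) => f p.2 * k (p.1 - p.2) := by fun_prop
  simp only [lmollify]
  rw [lintegral_lintegral_swap this.aemeasurable, ← lintegral_const_mul _ hf]
  refine lintegral_congr fun ζ => ?_
  rw [lintegral_const_mul _ (by fun_prop), lintegral_sub_right_eq_self k ζ, mul_comm]

theorem setLIntegral_ball_lmollify_le {f k : ℝ × ℝ → ENNReal} (hf : Measurable f)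
    (hk : Measurable k) {r R : ℝ} (hs : ∀ z, k z ≠ 0 → ‖z‖ < r) :
    ∫⁻ z in Metric.ball 0 R, lmollify f k z ≤
      (∫⁻ z, k z) * ∫⁻ z in Metric.ball 0 (R + r), f z := by
  rw [← lintegral_indicator Metric.isOpen_ball.measurableSet (f := f), ← lintegral_lmollify
    (hf.indicator Metric.isOpen_ball.measurableSet) hk]
  refine (setLIntegral_mono' Metric.isOpen_ball.measurableSet fun z hz => ?_).trans
    (setLIntegral_le_lintegral (Metric.ball 0 R) _)
  refine lintegral_mono fun ζ => ?_
  by_cases hkz : k (z - ζ) = 0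
  · simp [hkz]
  · have hζ : ζ ∈ Metric.ball (0 : ℝ × ℝ) (R + r) := by
      rw [mem_ball_zero_iff] at hz ⊢
      have h1 := hs _ hkz
      have h2 := norm_sub_le z (z - ζ)
      rw [sub_sub_cancel] at h2
      linarith
    rw [indicator_of_mem hζ]

/-- Jensen's inequality for the probability density `k (z - ·)`, obtained from Hölder; with
`lintegral_lmollify` it shows that mollifying does not increase the `L^p` norm. -/
theorem lmollify_rpow_le {f k : ℝ × ℝ → ENNReal} (hf : Measurable f) (hk : Measurable k)
    (h1 : ∫⁻ z, k z = 1) {p : ℝ} (hp : 1 < p) (z : ℝ × ℝ) :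
    lmollify f k z ^ p ≤ lmollify (fun ζ => f ζ ^ p) k z := by
  have hp0 : 0 < p := by linarith
  have hpc : 0 < 1 - 1 / p := by rw [sub_pos, div_lt_one hp0]; exact hp
  have hkz : ∫⁻ ζ, k (z - ζ) = 1 := by rw [lintegral_sub_left_eq_self k z, h1]
  have hol := ENNReal.lintegral_prod_norm_pow_le (μ := volume) (Finset.univ : Finset (Fin 2))
    (f := ![fun ζ => f ζ ^ p * k (z - ζ), fun ζ => k (z - ζ)]) (p := ![1 / p, 1 - 1 / p])
    (by
      intro i _
      fin_cases i
      · exact ((hf.pow_const p).mul (by fun_prop)).aemeasurable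
      · exact (show Measurable fun ζ => k (z - ζ) by fun_prop).aemeasurable)
    (by simp [Fin.sum_univ_two])
    (by
      intro i _
      fin_cases i
      · simp; positivity
      · simpa using hpc.le)
  simp only [Fin.prod_univ_two, Matrix.cons_val_zero, Matrix.cons_val_one, hkz,
    ENNReal.one_rpow, mul_one] at hol
  have hle : lmollify f k z ≤ lmollify (fun ζ => f ζ ^ p) k z ^ (1 / p) := by
    refine (lintegral_mono fun ζ => le_of_eq ?_).trans hol
    rw [ENNReal.mul_rpow_of_nonneg _ _ (by positivity : 0 ≤ 1 / p), ← ENNReal.rpow_mul,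
      mul_one_div_cancel hp0.ne', ENNReal.rpow_one, mul_assoc,
      ← ENNReal.rpow_add_of_nonneg _ _ (by positivity) hpc.le, add_sub_cancel, ENNReal.rpow_one]
  calc lmollify f k z ^ p ≤ (lmollify (fun ζ => f ζ ^ p) k z ^ (1 / p)) ^ p := by gcongr
    _ = _ := by rw [← ENNReal.rpow_mul, one_div_mul_cancel hp0.ne', ENNReal.rpow_one]

/-- By Tonelli the kernel is integrated in its first variable, and finite propagation confines the
source to a larger ball. This keeps the commutator error small in `L¹_loc`. -/
theorem setLIntegral_ball_coneKernel_le {g : ℝ × ℝ → ENNReal} (hg : Measurable g) {R : ℝ}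
    (hR : 0 < R) :
    ∫⁻ z in Metric.ball 0 R, ∫⁻ ζ, coneKernel (1 / 6) z ζ * g ζ ≤
      ENNReal.ofReal (3 * tricomiPhi R ^ (2 / 3 : ℝ) * R) *
        ∫⁻ ζ in Metric.ball 0 (R + tricomiPhi R), g ζ := by
  have mk := measurable_coneKernel (1 / 6)
  have mkg : Measurable fun p : (ℝ × ℝ) × (ℝ × ℝ) => coneKernel (1 / 6) p.1 p.2 * g p.2 := by
    fun_prop
  have hball : ∀ z : ℝ × ℝ, z ∈ Metric.ball 0 R → z.1 < R ∧ |z.2| < R := fun z hz => by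
    rw [mem_ball_zero_iff, Prod.norm_def, max_lt_iff, Real.norm_eq_abs, Real.norm_eq_abs] at hz
    exact ⟨(abs_lt.1 hz.1).2, hz.2⟩
  have hφR := tricomiPhi_pos hR
  rw [lintegral_lintegral_swap mkg.aemeasurable,
    ← lintegral_indicator Metric.isOpen_ball.measurableSet,
    ← lintegral_const_mul _ (hg.indicator Metric.isOpen_ball.measurableSet)]
  refine lintegral_mono fun ζ => ?_
  obtain ⟨s, y⟩ := ζ
  rw [lintegral_mul_const _ mk.of_uncurry_right]
  by_cases hζ : (s, y) ∈ Metric.ball (0 : ℝ × ℝ) (R + tricomiPhi R)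
  · rw [indicator_of_mem hζ]
    gcongr
    rcases le_or_gt s 0 with hs | hs
    · refine le_of_eq_of_le ?_ zero_le
      rw [← lintegral_zero]
      exact lintegral_congr fun z => coneKernel_of_nonpos hs
    calc ∫⁻ z in Metric.ball 0 R, coneKernel (1 / 6) z (s, y)
        ≤ ∫⁻ z : ℝ × ℝ, (Iio R).indicator (fun _ => (1 : ENNReal)) z.1 *
          coneKernel (1 / 6) z (s, y) := by
          refine (setLIntegral_mono' Metric.isOpen_ball.measurableSet fun z hz => ?_).trans
            (setLIntegral_le_lintegral (Metric.ball 0 R) _)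
          rw [indicator_of_mem (show z.1 ∈ Iio R from (hball z hz).1), one_mul]
      _ = ∫⁻ t : ℝ, ∫⁻ x : ℝ, (Iio R).indicator (fun _ => (1 : ENNReal)) t *
          coneKernel (1 / 6) (t, x) (s, y) := by
          have m1 : Measurable fun z : ℝ × ℝ => coneKernel (1 / 6) z (s, y) := mk.of_uncurry_right
          have m2 : Measurable fun t : ℝ => (Iio R).indicator (fun _ => (1 : ENNReal)) t :=
            measurable_const.indicator measurableSet_Iio
          rw [Measure.volume_eq_prod, lintegral_prod _
            (Measurable.aemeasurable (by fun_prop))]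
      _ ≤ ∫⁻ t : ℝ, (Ioc 0 R).indicator
          (fun _ => ENNReal.ofReal (3 * tricomiPhi R ^ (2 / 3 : ℝ))) t := by
          refine lintegral_mono fun t => ?_
          simp only
          by_cases htR : t < R
          · by_cases hst : t ≤ s
            · simp [coneKernel_of_le hst]
            push Not at hst
            have ht : 0 < t := hs.trans hst
            rw [indicator_of_mem (show t ∈ Iio R from htR),
              indicator_of_mem (show t ∈ Ioc 0 R from ⟨ht, htR.le⟩)]
            simp only [one_mul]
            refine (lintegral_coneKernel_left (by norm_num) hs hst).trans
              (ENNReal.ofReal_le_ofReal ?_)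
            have h1 := tricomiPhi_pos ht
            have h2 := tricomiPhi_le ht.le htR.le
            calc 2 / (1 - 1 / 6) * tricomiPhi t ^ (1 - 2 * (1 / 6) : ℝ)
                = 12 / 5 * tricomiPhi t ^ (2 / 3 : ℝ) := by norm_num
              _ ≤ 3 * tricomiPhi R ^ (2 / 3 : ℝ) := by gcongr; norm_num
          · rw [indicator_of_notMem (show t ∉ Iio R from htR)]
            simp
      _ = _ := by
          rw [lintegral_indicator measurableSet_Ioc, setLIntegral_const, Real.volume_Ioc, sub_zero,
            ← ENNReal.ofReal_mul (by positivity)]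
  · rw [indicator_of_notMem hζ, mul_zero]
    refine le_of_eq (mul_eq_zero_of_left ?_ _)
    rw [setLIntegral_congr_fun (g := fun _ => 0) Metric.isOpen_ball.measurableSet, lintegral_zero]
    rintro ⟨t, x⟩ hz
    obtain ⟨h1, h2⟩ := hball _ hz
    simp only
    rw [coneKernel, if_neg]
    rintro ⟨ht, hs, hc⟩
    simp only at h1 h2 ht hs hc
    have hs' := tricomiPhi_pos hs
    have htR := tricomiPhi_le ht.le h1.le
    have hst : s < t := lt_of_tricomiPhi_lt ht.le (by linarith [abs_nonneg (x - y)])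
    refine hζ ?_
    rw [mem_ball_zero_iff, Prod.norm_def, max_lt_iff, Real.norm_eq_abs, Real.norm_eq_abs,
      abs_of_pos hs]
    have h3 : |y| ≤ |x| + |x - y| := by
      have := abs_sub x (x - y)
      simpa using this
    exact ⟨by linarith, by linarith⟩

/-- Continuity of translations in `L¹`, by approximation with a continuous compactly supported
function. The radius must serve every `k` at once, since the mollifier is produced only after the
radius is given. -/
theorem exists_setLIntegral_ball_translate_le {f : ℝ × ℝ → ℝ} (hf : LocallyIntegrable f volume)
    (hfm : Measurable f) (R : ℝ) {ε : ENNReal} (hε : ε ≠ 0) (hε' : ε ≠ ⊤) :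
    ∃ r₀ : ℝ, 0 < r₀ ∧ r₀ ≤ 1 ∧ ∀ k : ℝ × ℝ → ENNReal, Measurable k → ∫⁻ z, k z = 1 →
      (∀ z, k z ≠ 0 → ‖z‖ < r₀) →
      ∫⁻ z in Metric.ball 0 R, ∫⁻ ζ, ‖f ζ - f z‖ₑ * k (z - ζ) ≤ ε := by
  have hε3 : ε / 3 ≠ 0 := by simp [hε]
  set B : Set (ℝ × ℝ) := Metric.ball 0 R with hB
  have hBm : MeasurableSet B := Metric.isOpen_ball.measurableSet
  set B' : Set (ℝ × ℝ) := Metric.ball 0 (R + 1) with hB'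
  have hB'm : MeasurableSet B' := Metric.isOpen_ball.measurableSet
  have hBB' : B ⊆ B' := Metric.ball_subset_ball (by linarith)
  have hint : Integrable (B'.indicator f) volume := by
    rw [integrable_indicator_iff hB'm]
    exact (hf.integrableOn_isCompact (isCompact_closedBall 0 (R + 1))).mono_set
      Metric.ball_subset_closedBall
  obtain ⟨g, hgs, hgε, hgc, -⟩ := hint.exists_hasCompactSupport_lintegral_sub_le hε3
  have happrox : ∫⁻ z in B', ‖f z - g z‖ₑ ≤ ε / 3 := by
    refine le_trans ?_ hgε
    refine (setLIntegral_mono' hB'm fun z hz => ?_).trans (setLIntegral_le_lintegral B' _)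
    rw [indicator_of_mem hz]
  have hvol : volume B ≠ ⊤ := measure_ball_lt_top.ne
  obtain ⟨η, hη, hηε⟩ : ∃ η : ℝ, 0 < η ∧ ENNReal.ofReal η * volume B ≤ ε / 3 := by
    refine ⟨(ε / 3 / (volume B + 1)).toReal, ENNReal.toReal_pos ?_ ?_, ?_⟩
    · exact ENNReal.div_ne_zero.2 ⟨hε3, by finiteness⟩
    · exact ENNReal.div_ne_top (ENNReal.div_ne_top hε' (by norm_num)) (by simp)
    · rw [ENNReal.ofReal_toReal
        (ENNReal.div_ne_top (ENNReal.div_ne_top hε' (by norm_num)) (by simp))]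
      calc ε / 3 / (volume B + 1) * volume B ≤ ε / 3 / (volume B + 1) * (volume B + 1) := by
            gcongr; exact le_self_add
        _ = ε / 3 := ENNReal.div_mul_cancel (by simp) (by finiteness)
  have huc := hgs.uniformContinuous_of_continuous hgc
  obtain ⟨r₁, hr₁, hgr⟩ := Metric.uniformContinuous_iff.1 huc η hη
  refine ⟨min r₁ 1, by positivity, min_le_right _ _, fun k hk hk1 hks => ?_⟩
  have hgm := hgc.measurable
  have hk1' : ∀ z, ∫⁻ ζ, k (z - ζ) = 1 := fun z => by
    rw [lintegral_sub_left_eq_self k z, hk1]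
  have pt : ∀ z, ∫⁻ ζ, ‖f ζ - f z‖ₑ * k (z - ζ) ≤
      lmollify (fun ζ => ‖f ζ - g ζ‖ₑ) k z + ENNReal.ofReal η + ‖f z - g z‖ₑ := by
    intro z
    have : ∀ ζ, ‖f ζ - f z‖ₑ * k (z - ζ) ≤ ‖f ζ - g ζ‖ₑ * k (z - ζ) +
        (ENNReal.ofReal η + ‖f z - g z‖ₑ) * k (z - ζ) := by
      intro ζ
      by_cases hkz : k (z - ζ) = 0
      · simp [hkz]
      rw [← add_mul]
      gcongr
      have h1 : dist ζ z < r₁ := by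
        rw [dist_eq_norm, norm_sub_rev]
        exact (hks _ hkz).trans_le (min_le_left _ _)
      have h2 : ‖g ζ - g z‖ₑ ≤ ENNReal.ofReal η := by
        rw [← ofReal_norm, ← dist_eq_norm]
        exact ENNReal.ofReal_le_ofReal (hgr h1).le
      calc ‖f ζ - f z‖ₑ = ‖(f ζ - g ζ) + ((g ζ - g z) + (g z - f z))‖ₑ := by congr 1; ring
        _ ≤ ‖f ζ - g ζ‖ₑ + (‖g ζ - g z‖ₑ + ‖g z - f z‖ₑ) :=
          (enorm_add_le _ _).trans (add_le_add le_rfl (enorm_add_le _ _))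
        _ ≤ _ := by rw [enorm_sub_rev (g z)]; gcongr
    refine (lintegral_mono this).trans (le_of_eq ?_)
    rw [lintegral_add_left (by fun_prop), lintegral_const_mul _ (by fun_prop), hk1', mul_one,
      lmollify, add_assoc]
  have hm1 : Measurable (lmollify (fun ζ => ‖f ζ - g ζ‖ₑ) k) :=
    measurable_lmollify (by fun_prop) hk
  calc ∫⁻ z in B, ∫⁻ ζ, ‖f ζ - f z‖ₑ * k (z - ζ)
      ≤ ∫⁻ z in B, (lmollify (fun ζ => ‖f ζ - g ζ‖ₑ) k z + ENNReal.ofReal η + ‖f z - g z‖ₑ) :=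
        lintegral_mono pt
    _ = (∫⁻ z in B, lmollify (fun ζ => ‖f ζ - g ζ‖ₑ) k z) + ENNReal.ofReal η * volume B
        + ∫⁻ z in B, ‖f z - g z‖ₑ := by
        rw [lintegral_add_left (by fun_prop), lintegral_add_left hm1, setLIntegral_const]
    _ ≤ ε / 3 + ε / 3 + ε / 3 := by
        refine add_le_add (add_le_add ?_ hηε) ((lintegral_mono_set hBB').trans happrox)
        refine (setLIntegral_ball_lmollify_le (by fun_prop) hk
          (fun z hz => (hks z hz).trans_le (min_le_right _ _))).trans ?_
        rw [hk1, one_mul]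
        exact happrox
    _ = ε := ENNReal.add_thirds ε

theorem setLIntegral_ball_enorm_lt_top {f : ℝ × ℝ → ℝ} (hf : LocallyIntegrable f volume) (R : ℝ) :
    ∫⁻ z in Metric.ball 0 R, ‖f z‖ₑ < ⊤ :=
  ((hf.integrableOn_isCompact (isCompact_closedBall 0 R)).mono_set
    Metric.ball_subset_closedBall).hasFiniteIntegral

/-- A sequence of mollifiers along which a distributional solution is bounded by the cone kernel
applied to the mollified source, up to an error that tends to zero almost everywhere. -/
theorem exists_mollifier_seq : ∃ A : ℝ, 0 < A ∧ ∀ f F : ℝ × ℝ → ℝ,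
    LocallyIntegrable f volume → Measurable f → Measurable F →
    (∀ z : ℝ × ℝ, z.1 ≤ 0 → f z = 0) → (∀ z : ℝ × ℝ, z.1 ≤ 0 → F z = 0) →
    (∀ ψ : ℝ × ℝ → ℝ, ContDiff ℝ ∞ ψ → HasCompactSupport ψ →
      ∫ z, f z * tricomiOp ψ z = ∫ z, F z * ψ z) →
    ∃ (k : ℕ → ℝ × ℝ → ENNReal) (E : ℕ → ℝ × ℝ → ENNReal),
      (∀ n, Measurable (k n)) ∧ (∀ n, ∫⁻ z, k n z = 1) ∧
      (∀ n z, k n z ≠ 0 → 0 < z.1 ∧ ‖z‖ < 1) ∧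
      (∀ n, ∀ z : ℝ × ℝ, 0 < z.1 → ‖f z‖ₑ ≤ E n z +
        ENNReal.ofReal A * ∫⁻ ζ, coneKernel (1 / 6) z ζ * lmollify (fun ζ => ‖F ζ‖ₑ) (k n) ζ) ∧
      ∀ᵐ z, Filter.Tendsto (fun n => E n z) Filter.atTop (nhds 0) := by
  obtain ⟨A, hA, hreg⟩ := exists_enorm_le_regularized
  refine ⟨A, hA, fun f F hf hfm hFm hf0 hF0 hw => ?_⟩
  have mK := measurable_coneKernel (1 / 6)
  have step : ∀ n : ℕ, ∃ k E : ℝ × ℝ → ENNReal, Measurable k ∧ Measurable E ∧ ∫⁻ z, k z = 1 ∧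
      (∀ z, k z ≠ 0 → 0 < z.1 ∧ ‖z‖ < 1) ∧
      (∀ z : ℝ × ℝ, 0 < z.1 → ‖f z‖ₑ ≤ E z +
        ENNReal.ofReal A * ∫⁻ ζ, coneKernel (1 / 6) z ζ * lmollify (fun ζ => ‖F ζ‖ₑ) k ζ) ∧
      ∫⁻ z in Metric.ball 0 ((n : ℝ) + 1), E z ≤ 2 * (1 / 2) ^ n := by
    intro n
    set R : ℝ := (n : ℝ) + 1 with hR
    have hR0 : 0 < R := by positivity
    set ε : ENNReal := (1 / 2) ^ n with hε
    have hε0 : ε ≠ 0 := pow_ne_zero _ (by simp)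
    have hεt : ε ≠ ⊤ := by rw [hε]; finiteness
    obtain ⟨r₀, hr₀, hr₀1, htrans⟩ := exists_setLIntegral_ball_translate_le hf hfm R hε0 hεt
    set R' := R + tricomiPhi R with hR'
    set K : ENNReal := ENNReal.ofReal A * (ENNReal.ofReal (3 * tricomiPhi R ^ (2 / 3 : ℝ) * R) *
      ∫⁻ z in Metric.ball 0 (R' + 1), ‖f z‖ₑ) with hK
    have hKt : K ≠ ⊤ := by
      have := (setLIntegral_ball_enorm_lt_top hf (R' + 1)).ne
      finiteness
    obtain ⟨η, hη, hηε⟩ : ∃ η : ℝ, 0 < η ∧ ENNReal.ofReal η * K ≤ ε := by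
      refine ⟨(ε / (K + 1)).toReal, ENNReal.toReal_pos ?_ ?_, ?_⟩
      · exact ENNReal.div_ne_zero.2 ⟨hε0, by finiteness⟩
      · exact ENNReal.div_ne_top hεt (by simp)
      · rw [ENNReal.ofReal_toReal (ENNReal.div_ne_top hεt (by simp))]
        calc ε / (K + 1) * K ≤ ε / (K + 1) * (K + 1) := by gcongr; exact le_self_add
          _ = ε := ENNReal.div_mul_cancel (by simp) (by finiteness)
    obtain ⟨k, c, hk, hc, hk1, hcr, hks, hcs, hmain⟩ :=
      -- The bound `r₀` controls the translation error, and `η` the commutator error through the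
      -- constant `K`.
      hreg f F hf hf0 hF0 hw (min r₀ η) (by positivity)
    have mcf : Measurable (lmollify (fun ζ => ‖f ζ‖ₑ) c) := measurable_lmollify (by fun_prop) hc
    have mkF : Measurable (lmollify (fun ζ => ‖F ζ‖ₑ) k) := measurable_lmollify (by fun_prop) hk
    have m1 : Measurable fun z => ∫⁻ ζ, ‖f ζ - f z‖ₑ * k (z - ζ) :=
      Measurable.lintegral_prod_right' (f := fun p : (ℝ × ℝ) × (ℝ × ℝ) =>
        ‖f p.2 - f p.1‖ₑ * k (p.1 - p.2)) (by fun_prop)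
    have m2 : Measurable fun z =>
        ∫⁻ ζ, coneKernel (1 / 6) z ζ * lmollify (fun ζ => ‖f ζ‖ₑ) c ζ :=
      Measurable.lintegral_prod_right' (f := fun p : (ℝ × ℝ) × (ℝ × ℝ) =>
        coneKernel (1 / 6) p.1 p.2 * lmollify (fun ζ => ‖f ζ‖ₑ) c p.2) (by fun_prop)
    refine ⟨k, fun z => (∫⁻ ζ, ‖f ζ - f z‖ₑ * k (z - ζ)) + ENNReal.ofReal A *
      ∫⁻ ζ, coneKernel (1 / 6) z ζ * lmollify (fun ζ => ‖f ζ‖ₑ) c ζ, hk, by fun_prop, hk1,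
      fun z hz => ⟨(hks z hz).1, (hks z hz).2.trans_le ((min_le_left _ _).trans hr₀1)⟩,
      fun z hz => (hmain z hz).trans (le_of_eq ?_), ?_⟩
    · have mz : Measurable fun ζ => coneKernel (1 / 6) z ζ := mK.of_uncurry_left
      simp only [mul_add]
      rw [lintegral_add_left (by fun_prop), mul_add]
      ring
    · rw [lintegral_add_left m1, lintegral_const_mul _ m2, two_mul]
      refine add_le_add (htrans k hk hk1 fun z hz => (hks z hz).2.trans_le (min_le_left _ _)) ?_
      refine le_trans ?_ hηε
      calc _ ≤ ENNReal.ofReal A * (ENNReal.ofReal (3 * tricomiPhi R ^ (2 / 3 : ℝ) * R) *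
            ∫⁻ ζ in Metric.ball 0 R', lmollify (fun ζ => ‖f ζ‖ₑ) c ζ) := by
            gcongr
            exact setLIntegral_ball_coneKernel_le mcf hR0
        _ ≤ ENNReal.ofReal A * (ENNReal.ofReal (3 * tricomiPhi R ^ (2 / 3 : ℝ) * R) *
            (ENNReal.ofReal η * ∫⁻ z in Metric.ball 0 (R' + 1), ‖f z‖ₑ)) := by
            gcongr
            refine (setLIntegral_ball_lmollify_le (r := 1) (by fun_prop) hc fun z hz =>
              (hcs z hz).trans_le ((min_le_left _ _).trans hr₀1)).trans ?_
            gcongr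
            exact hcr.trans (ENNReal.ofReal_le_ofReal (min_le_right _ _))
        _ = _ := by rw [hK]; ring
  choose k E hk hE hk1 hks hmain hEint using step
  refine ⟨k, E, hk, hk1, hks, hmain, ?_⟩
  -- The integrals of `G n` are summable, so `∑ G n` is finite almost everywhere and `G n → 0` there
  -- without passing to a subsequence. Each point lies in all but finitely many of the balls, where
  -- `G n = E n`.
  set G : ℕ → ℝ × ℝ → ENNReal := fun n => (Metric.ball 0 ((n : ℝ) + 1)).indicator (E n) with hG
  have hGm : ∀ n, Measurable (G n) := fun n => (hE n).indicator Metric.isOpen_ball.measurableSet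
  have hsum : ∫⁻ z, ∑' n, G n z ≠ ⊤ := by
    rw [lintegral_tsum fun n => (hGm n).aemeasurable]
    refine ne_top_of_le_ne_top ?_ (ENNReal.tsum_le_tsum fun n => (?_ : _ ≤ 2 * (1 / 2 : ENNReal) ^ n))
    · rw [ENNReal.tsum_mul_left, ENNReal.tsum_geometric]
      norm_num
    · rw [hG, lintegral_indicator Metric.isOpen_ball.measurableSet]
      exact hEint n
  filter_upwards [ae_lt_top' (AEMeasurable.tsum fun n => (hGm n).aemeasurable) hsum]
    with z hz
  refine (ENNReal.tendsto_atTop_zero_of_tsum_ne_top hz.ne).congr' ?_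
  obtain ⟨m, hm⟩ := exists_nat_gt ‖z‖
  filter_upwards [Filter.eventually_ge_atTop m] with n hn
  rw [hG]
  refine indicator_of_mem ?_ _
  rw [mem_ball_zero_iff]
  have : (m : ℝ) ≤ n := by exact_mod_cast hn
  linarith

/-! ### The weighted Strichartz estimate -/

theorem exists_lintegral_weight_rpow_le : ∃ A : ℝ, 0 < A ∧ ∀ (q q' κ M : ℝ) (f F : ℝ × ℝ → ℝ),
    6 < q → q < 10 → q' = q / (q - 1) → κ = 5 / (3 * q) - 1 / 6 → 0 < M →
    LocallyIntegrable f volume → Measurable f → Measurable F →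
    (∀ z : ℝ × ℝ, z.1 ≤ 0 → f z = 0) → (∀ z : ℝ × ℝ, z.1 ≤ 0 → F z = 0) →
    (∀ z : ℝ × ℝ, tricomiPhi z.1 + M - 1 < |z.2| → F z = 0) →
    (∀ ψ : ℝ × ℝ → ℝ, ContDiff ℝ ∞ ψ → HasCompactSupport ψ →
      ∫ z, f z * tricomiOp ψ z = ∫ z, F z * ψ z) →
    ∫⁻ z in Ioi (0 : ℝ) ×ˢ univ, (‖((tricomiPhi z.1 + M) ^ 2 - z.2 ^ 2) ^ (-κ)‖ₑ * ‖f z‖ₑ) ^ q ≤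
      ENNReal.ofReal A ^ q * (48 * 48 * (∫⁻ ζ, ‖F ζ‖ₑ ^ q') ^ (q - 1)) := by
  obtain ⟨A, hA, hseq⟩ := exists_mollifier_seq
  refine ⟨A, hA, fun q q' κ M f F hq hq10 hqq hκ hM hf hfm hFm hf0 hF0 hFs hw => ?_⟩
  obtain ⟨k, E, hk, hk1, hks, hmain, hlim⟩ := hseq f F hf hfm hFm hf0 hF0 hw
  have hq0 : 0 < q := by linarith
  have hq'1 : 1 < q' := by rw [hqq, lt_div_iff₀ (by linarith)]; linarith
  set ρ : ℝ × ℝ → ENNReal := fun z => ‖((tricomiPhi z.1 + M) ^ 2 - z.2 ^ 2) ^ (-κ)‖ₑ with hρ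
  have hρt : ∀ z, ρ z ≠ ⊤ := fun z => by simp only [hρ]; finiteness
  have hρm : Measurable ρ := by
    have := continuous_tricomiPhi.measurable
    fun_prop
  set N : ℕ → ℝ × ℝ → ENNReal := fun n => lmollify (fun ζ => ‖F ζ‖ₑ) (k n) with hN
  have hNm : ∀ n, Measurable (N n) := fun n => measurable_lmollify (by fun_prop) (hk n)
  set I : ℕ → ℝ × ℝ → ENNReal := fun n z => ∫⁻ ζ, coneKernel (1 / 6) z ζ * N n ζ with hI
  have hIm : ∀ n, Measurable (I n) := fun n => by
    have := measurable_coneKernel (1 / 6)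
    have := hNm n
    exact Measurable.lintegral_prod_right' (f := fun p : (ℝ × ℝ) × (ℝ × ℝ) =>
      coneKernel (1 / 6) p.1 p.2 * N n p.2) (by fun_prop)
  -- The mollifier moves points forward in time, where `φ` is larger, and by less than `1` in space;
  -- the margin `M - 1` against `M` absorbs this.
  have hNs : ∀ n, ∀ ζ : ℝ × ℝ, 0 < ζ.1 → tricomiPhi ζ.1 + M < |ζ.2| → N n ζ = 0 := by
    intro n ζ hζ hζM
    simp only [hN, lmollify]
    refine lintegral_eq_zero_of_ae_eq_zero (Filter.Eventually.of_forall fun ξ => ?_)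
    by_contra hne
    simp only [Pi.zero_apply, mul_eq_zero, not_or, enorm_eq_zero] at hne
    obtain ⟨hFξ, hkξ⟩ := hne
    obtain ⟨h1, h2⟩ := hks n _ hkξ
    rw [Prod.norm_def, max_lt_iff, Real.norm_eq_abs, Real.norm_eq_abs] at h2
    simp only [Prod.fst_sub, Prod.snd_sub] at h1 h2
    have h3 : 0 < ξ.1 := by
      by_contra! h
      exact hFξ (hF0 ξ h)
    have h4 : |ξ.2| ≤ tricomiPhi ξ.1 + M - 1 := by
      by_contra! h
      exact hFξ (hFs ξ h)
    have h5 := tricomiPhi_le h3.le (by linarith : ξ.1 ≤ ζ.1)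
    have h6 : |ζ.2| ≤ |ζ.2 - ξ.2| + |ξ.2| := by simpa using abs_add_le (ζ.2 - ξ.2) ξ.2
    linarith [h2.2]
  have hNint : ∀ n, ∫⁻ ζ, N n ζ ^ q' ≤ ∫⁻ ζ, ‖F ζ‖ₑ ^ q' := fun n => by
    calc ∫⁻ ζ, N n ζ ^ q' ≤ ∫⁻ ζ, lmollify (fun ζ => ‖F ζ‖ₑ ^ q') (k n) ζ :=
          lintegral_mono fun ζ => lmollify_rpow_le (by fun_prop) (hk n) (hk1 n) hq'1 ζ
      _ = _ := by rw [lintegral_lmollify (by fun_prop) (hk n), hk1, one_mul]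
  have hS : MeasurableSet (Ioi (0 : ℝ) ×ˢ (univ : Set ℝ)) := measurableSet_Ioi.prod .univ
  have hbound : ∀ n, ∫⁻ z in Ioi (0 : ℝ) ×ˢ univ, (ρ z * (ENNReal.ofReal A * I n z)) ^ q ≤
      ENNReal.ofReal A ^ q * (48 * 48 * (∫⁻ ζ, ‖F ζ‖ₑ ^ q') ^ (q - 1)) := by
    intro n
    have key := lintegral_weight_mul_cone_rpow_le hq hq10 hqq hκ hM (hNm n) (hNs n)
    calc ∫⁻ z in Ioi (0 : ℝ) ×ˢ univ, (ρ z * (ENNReal.ofReal A * I n z)) ^ q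
        = ∫⁻ z in Ioi (0 : ℝ) ×ˢ univ, ENNReal.ofReal A ^ q *
          (ρ z * ∫⁻ ζ in tricomiCone z,
            ENNReal.ofReal (coneDist z ζ ^ (-(1 / 6) : ℝ)) * N n ζ) ^ q := by
          refine setLIntegral_congr_fun hS fun z hz => ?_
          simp only [hI]
          rw [setLIntegral_tricomiCone hz.1, ← ENNReal.mul_rpow_of_nonneg _ _ hq0.le]
          congr 1
          ring
      _ = ENNReal.ofReal A ^ q * _ :=
          lintegral_const_mul' _ _ (ENNReal.rpow_ne_top_of_nonneg hq0.le ENNReal.ofReal_ne_top)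
      _ ≤ _ := by
          refine mul_le_mul' le_rfl (key.trans (mul_le_mul' le_rfl ?_))
          exact ENNReal.rpow_le_rpow (hNint n) (by linarith)
  calc ∫⁻ z in Ioi (0 : ℝ) ×ˢ univ, (ρ z * ‖f z‖ₑ) ^ q
      ≤ ∫⁻ z in Ioi (0 : ℝ) ×ˢ univ, Filter.liminf
          (fun n => (ρ z * (ENNReal.ofReal A * I n z)) ^ q) Filter.atTop := by
        refine lintegral_mono_ae ?_
        filter_upwards [ae_restrict_mem hS, ae_restrict_of_ae hlim] with z hz hE
        -- The error is subtracted before the limit is taken: `‖f z‖ₑ - E n z`, truncated at zero,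
        -- is bounded by the kernel term and tends to `‖f z‖ₑ`, so Fatou applies to the kernel terms
        -- alone.
        have h1 : Filter.Tendsto (fun n => (ρ z * (‖f z‖ₑ - E n z)) ^ q) Filter.atTop
            (nhds ((ρ z * (‖f z‖ₑ - 0)) ^ q)) :=
          ((ENNReal.continuous_rpow_const (y := q)).tendsto _).comp
            (ENNReal.Tendsto.const_mul (ENNReal.Tendsto.sub tendsto_const_nhds hE
              (Or.inl enorm_ne_top)) (Or.inr (hρt z)))
        rw [tsub_zero] at h1
        rw [← h1.liminf_eq]
        refine Filter.liminf_le_liminf (Filter.Eventually.of_forall fun n => ?_)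
        gcongr
        rw [tsub_le_iff_left]
        exact hmain n z hz.1
    _ ≤ Filter.liminf (fun n => ∫⁻ z in Ioi (0 : ℝ) ×ˢ univ,
          (ρ z * (ENNReal.ofReal A * I n z)) ^ q) Filter.atTop :=
        lintegral_liminf_le fun n => by have := hIm n; fun_prop
    _ ≤ _ := by
        refine (Filter.liminf_le_liminf (Filter.Eventually.of_forall hbound)).trans ?_
        exact (Filter.liminf_const _).le

theorem locallyIntegrable_indicator_Ioi_prod {f : ℝ × ℝ → ℝ}
    (hf : LocallyIntegrableOn f (Ici 0 ×ˢ univ) volume) :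
    LocallyIntegrable ((Ioi (0 : ℝ) ×ˢ (univ : Set ℝ)).indicator f) volume := by
  rw [locallyIntegrable_iff]
  intro K hK
  have hS : MeasurableSet (Ioi (0 : ℝ) ×ˢ (univ : Set ℝ)) := measurableSet_Ioi.prod .univ
  have hcl : IsClosed (Ici (0 : ℝ) ×ˢ (univ : Set ℝ)) := isClosed_Ici.prod isClosed_univ
  have h := hf.integrableOn_compact_subset inter_subset_right (hK.inter_right hcl)
  rw [IntegrableOn, integrable_indicator_iff hS, IntegrableOn, Measure.restrict_restrict hS]
  exact h.mono_set fun z hz => ⟨hz.2, mem_Ici.2 (le_of_lt hz.1.1), mem_univ _⟩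

theorem theorem3p3 (p q : ℝ) (hp : 5 < p) (hp9 : p < 9) (hq : q = p + 1) :
    ∃ α β : ℝ, α + 1 / 6 + β = 5 / (3 * q) ∧ β < 1 / q ∧
      ∃ C : ℝ, 0 < C ∧
        ∀ M T₀ : ℝ, 1 < M → 0 < T₀ → T₀ < 1 →
          ∀ F w : ℝ × ℝ → ℝ,
            IsTricomiSolution F w →
            (∀ t x : ℝ, 0 ≤ t → tricomiPhi t + M - 1 < |x| → F (t, x) = 0) →
            (∀ t x : ℝ, 0 ≤ t → t < T₀ / 2 → F (t, x) = 0) →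
            weightedNorm M (T₀ / 2) (-α) q w ≤
              ENNReal.ofReal C * weightedNorm M (T₀ / 2) β (q / (q - 1)) F := by
  obtain ⟨A, hA, hmain⟩ := exists_lintegral_weight_rpow_le
  have hq0 : 0 < q := by linarith
  have hq1 : 0 < q - 1 := by linarith
  -- With `β = 0` the source carries no weight. The constant is the `q`-th root of the bound in
  -- `exists_lintegral_weight_rpow_le`.
  refine ⟨5 / (3 * q) - 1 / 6, 0, by ring, by positivity, A * (48 * 48) ^ (1 / q), by positivity, ?_⟩
  intro M T₀ hM hT₀ _ F w hsol hFx hFt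
  set S : Set (ℝ × ℝ) := Ioi 0 ×ˢ univ with hS
  have hSm : MeasurableSet S := measurableSet_Ioi.prod .univ
  have hwS := locallyIntegrable_indicator_Ioi_prod hsol.locallyIntegrable_sol
  have hFS := locallyIntegrable_indicator_Ioi_prod hsol.locallyIntegrable_source
  have hwm := hwS.aestronglyMeasurable
  have hFm := hFS.aestronglyMeasurable
  set f : ℝ × ℝ → ℝ := S.indicator (hwm.mk _) with hf
  -- A measurable representative agrees with `F` only almost everywhere; cutting it off to `S'`
  -- restores the support condition at every point.
  set S' : Set (ℝ × ℝ) := S ∩ {z | |z.2| ≤ tricomiPhi z.1 + M - 1} with hS'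
  set G : ℝ × ℝ → ℝ := S'.indicator (hFm.mk _) with hG
  have hS'm : MeasurableSet S' := by
    have := continuous_tricomiPhi.measurable
    exact hSm.inter (measurableSet_le (f := fun z : ℝ × ℝ => |z.2|)
      (g := fun z : ℝ × ℝ => tricomiPhi z.1 + M - 1) (by fun_prop) (by fun_prop))
  have hfw : f =ᵐ[volume] S.indicator w := by
    filter_upwards [hwm.ae_eq_mk] with z hz
    by_cases h : z ∈ S
    · rw [hf, indicator_of_mem h, ← hz]
    · rw [hf, indicator_of_notMem h, indicator_of_notMem h]
  have hGF : G =ᵐ[volume] S.indicator F := by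
    filter_upwards [hFm.ae_eq_mk] with z hz
    by_cases h : z ∈ S'
    · rw [hG, indicator_of_mem h, ← hz]
    · rw [hG, indicator_of_notMem h]
      by_cases h' : z ∈ S
      · rw [indicator_of_mem h']
        refine (hFx z.1 z.2 (le_of_lt h'.1) ?_).symm
        by_contra! hc
        exact h ⟨h', hc⟩
      · rw [indicator_of_notMem h']
  have weak : ∀ ψ : ℝ × ℝ → ℝ, ContDiff ℝ ∞ ψ → HasCompactSupport ψ →
      ∫ z, f z * tricomiOp ψ z = ∫ z, G z * ψ z := by
    intro ψ h1 h2
    have h := hsol.weak_eq ψ h1 h2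
    rw [← integral_indicator hSm, ← integral_indicator hSm] at h
    refine (integral_congr_ae ?_).trans (h.trans (integral_congr_ae ?_))
    · filter_upwards [hfw] with z hz
      rw [hz, indicator_mul_left]
    · filter_upwards [hGF] with z hz
      rw [hz, indicator_mul_left]
  have est := hmain q (q / (q - 1)) (5 / (3 * q) - 1 / 6) M f G (by linarith) (by linarith) rfl rfl
    (by linarith) (hwS.congr (hfw.symm)) (hwm.stronglyMeasurable_mk.measurable.indicator hSm)
    (hFm.stronglyMeasurable_mk.measurable.indicator hS'm)
    (fun z hz => indicator_of_notMem (fun h => absurd h.1 hz.not_gt) _)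
    (fun z hz => indicator_of_notMem (fun h => absurd h.1.1 hz.not_gt) _)
    (fun z hz => indicator_of_notMem (fun h => absurd h.2 hz.not_ge) _) weak
  have hq' : 0 < q / (q - 1) := by positivity
  have hTS : Ici (T₀ / 2) ×ˢ univ ⊆ S := fun z hz => ⟨by
    have : T₀ / 2 ≤ z.1 := hz.1
    exact (half_pos hT₀).trans_le this, mem_univ _⟩
  have hTm : MeasurableSet (Ici (T₀ / 2) ×ˢ (univ : Set ℝ)) := measurableSet_Ici.prod .univ
  -- The estimate is proved on all of `t > 0`; the vanishing of `F` before `T₀ / 2` enters only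
  -- here, to restrict the source norm, so the constant does not depend on `T₀`.
  have hGint : ∫⁻ ζ, ‖G ζ‖ₑ ^ (q / (q - 1)) =
      ∫⁻ z in Ici (T₀ / 2) ×ˢ univ, ‖F z‖ₑ ^ (q / (q - 1)) := by
    rw [← lintegral_indicator hTm]
    refine lintegral_congr_ae ?_
    filter_upwards [hGF] with z hz
    rw [hz]
    by_cases h : z ∈ Ici (T₀ / 2) ×ˢ (univ : Set ℝ)
    · rw [indicator_of_mem h, indicator_of_mem (hTS h)]
    · rw [indicator_of_notMem h]
      have : S.indicator F z = 0 := by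
        refine indicator_apply_eq_zero.2 fun hz => ?_
        refine hFt z.1 z.2 (le_of_lt hz.1) ?_
        by_contra! hc
        exact h ⟨hc, mem_univ _⟩
      rw [this, enorm_zero, ENNReal.zero_rpow_of_pos hq']
  have hleft : weightedNorm M (T₀ / 2) (-(5 / (3 * q) - 1 / 6)) q w ≤
      (∫⁻ z in S, (‖((tricomiPhi z.1 + M) ^ 2 - z.2 ^ 2) ^ (-(5 / (3 * q) - 1 / 6))‖ₑ *
        ‖f z‖ₑ) ^ q) ^ (1 / q) := by
    rw [weightedNorm, eLpNorm_eq_lintegral_rpow_enorm_toReal (by simpa using hq0)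
      ENNReal.ofReal_ne_top, ENNReal.toReal_ofReal hq0.le]
    refine ENNReal.rpow_le_rpow (le_trans (le_of_eq ?_) (lintegral_mono_set hTS)) (by positivity)
    refine lintegral_congr_ae ?_
    filter_upwards [ae_restrict_mem hTm, ae_restrict_of_ae hfw] with z hz hfz
    rw [hfz, indicator_of_mem (hTS hz), enorm_mul]
  have hright : weightedNorm M (T₀ / 2) 0 (q / (q - 1)) F =
      (∫⁻ ζ, ‖G ζ‖ₑ ^ (q / (q - 1))) ^ ((q - 1) / q) := by
    rw [weightedNorm, eLpNorm_eq_lintegral_rpow_enorm_toReal (by simpa using hq')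
      ENNReal.ofReal_ne_top, ENNReal.toReal_ofReal hq'.le, hGint, one_div_div]
    simp only [Real.rpow_zero, one_mul]
  refine hleft.trans ((ENNReal.rpow_le_rpow est (by positivity)).trans (le_of_eq ?_))
  have h48 : (48 * 48 : ENNReal) = ENNReal.ofReal (48 * 48) := by
    rw [ENNReal.ofReal_mul (by norm_num)]
    norm_num
  rw [hright, ENNReal.mul_rpow_of_nonneg _ _ (by positivity),
    ENNReal.mul_rpow_of_nonneg _ _ (by positivity), ← ENNReal.rpow_mul, ← ENNReal.rpow_mul,
    mul_one_div_cancel hq0.ne', ENNReal.rpow_one, h48,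
    ENNReal.ofReal_rpow_of_pos (by norm_num), ENNReal.ofReal_mul hA.le, mul_one_div, mul_assoc]
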